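/- **Theorem 3.3.** Let $(M,J)$ be an almost complex manifold of real dimension $2n$: $M$ is a smooth manifold and $J$ is a smooth field of endomorphisms of the tangent spaces with $J^2=-\mathrm{id}$. Let $\Gamma\subset M$ be a smooth (embedded) real hypersurface. *Notation on $M$.* The Nijenhuis tensor of $J$ is $N(X,Y)=[JX,JY]-[X,Y]-J([X,JY]+[JX,Y])$, and $J$ is called integrable if $N\equiv 0$. For a submanifold $S$ of a manifold with a field $K$ of endomorphisms of its tangent spaces, the $K$-invariant subspace of $S$ at $x\in S$ is $\{v\in T_xS : Kv\in T_xS\}$, and $S$ is totally real if all these subspaces are $\{0\}$. Let $\mathcal D_x=\{v\in T_x\Gamma : Jv\in T_x\Gamma\}$ be the $J$-invariant distribution of $\Gamma$. A (local) defining $1$-form of $\mathcal D$ is a smooth $1$-form $\vartheta$ on an open subset of $\Gamma$ with $\ker\vartheta_y=\mathcal D_y$ at all points $y$ of that subset; put $\mathbb L_x(v,w)=-d\vartheta_x(v,Jw)$ for $v,w\in\mathcal D_x$, where $d\vartheta(X,Y)=X(\vartheta(Y))-Y(\vartheta(X))-\vartheta([X,Y])$. We say that - $\mathcal D$ is contact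 if every $x\in\Gamma$ has a neighbourhood in $\Gamma$ with a defining $1$-form $\vartheta$ such that $d\vartheta_x$ is non-degenerate on $\mathcal D_x$; - $\Gamma$ is Levi non-degenerate if every $x\in\Gamma$ has a neighbourhood with a defining $1$-form such that the symmetric part $\tfrac12(\mathbb L_x(v,w)+\mathbb L_x(w,v))$ is non-degenerate on $\mathcal D_x$; - $\Gamma$ is strongly pseudoconvex if every $x\in\Gamma$ has a neighbourhood with a defining $1$-form such that the Levi form $\mathcal L_x(v)=\mathbb L_x(v,v)$ is positive definite on $\mathcal D_x$. *Notation on $T^*M$.* Let $\pi:T^*M\to M$ be the projection, $\theta_\alpha(V)=\alpha(\pi_*V)$ the tautological $1$-form, $\omega=d\theta$ the canonical symplectic form, $\hat J:T^*M\to T^*M$ the map $\hat J(\alpha)=\alpha\circ J$, $g^J_\alpha(V,W)=\tfrac12\,\alpha\big(N(\pi_*V,J\pi_*W)\big)$ and $\varpi^J=d(\hat J^*\theta)+g^J$. The Ishihara–Yano lift of $J$ is the field $\mathbb J$ of endomorphisms of the tangent spaces of $T^*M$ determined by $\omega(\mathbb JV,W)=\varpi^J(V,W)$ for all $V,W\in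 T_\alpha(T^*M)$. The conormal bundle of $\Gamma$ is $\mathcal N^*(\Gamma)=\{\alpha\in T_x^*M : x\in\Gamma,\ \alpha|_{T_x\Gamma}=0\}$. *Claim.* If $J$ is integrable, then $\mathcal D$ is contact if and only if $\Gamma$ is Levi non-degenerate. Suppose that at least one of the following holds: (i) $J$ is integrable and $\mathcal D$ is contact (i.e. $\Gamma$ is Levi non-degenerate); (ii) $\Gamma$ is strongly pseudoconvex ($J$ need not be integrable). Then $\mathcal N^*(\Gamma)\setminus\{\text{zero section}\}$ is an embedded submanifold of $T^*M$ of codimension $2n$, and it is totally real with respect to $\mathbb J$. -/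

import Mathlib

open Set Filter Bundle Module
open scoped Manifold ContDiff Topology

noncomputable section

namespace AlmostComplex

section OneForms

variable {E : Type*} [NormedAddCommGroup E] [NormedSpace ℝ E]
  {H : Type*} [TopologicalSpace H] (I : ModelWithCorners ℝ E H)
  {M : Type*} [TopologicalSpace M] [ChartedSpace H M]
  {E' : Type*} [NormedAddCommGroup E'] [NormedSpace ℝ E']
  {H' : Type*} [TopologicalSpace H'] (I' : ModelWithCorners ℝ E' H')
  {M' : Type*} [TopologicalSpace M'] [ChartedSpace H' M']

/-- A (not necessarily smooth) differential 1-form on the manifold `M`. -/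
abbrev OneForm (M : Type*) [TopologicalSpace M] [ChartedSpace H M] : Type _ :=
  ∀ x : M, TangentSpace I x →L[ℝ] ℝ

variable {I I'}

/-- The pull-back `f^* ϑ` of a 1-form: `(f^* ϑ)_x (v) = ϑ_{f x} (f_* v)`. -/
def OneForm.pullback (f : M → M') (ϑ : OneForm I' M') : OneForm I M :=
  fun x => (ϑ (f x)).comp (mfderiv I I' f x)

/-- The expression of a 1-form in the preferred chart at `x`, i.e. its pull-back under the inverse
of that chart. -/
def OneForm.inChart (ϑ : OneForm I M) (x : M) (z : E) : E →L[ℝ] ℝ :=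
  (ϑ ((extChartAt I x).symm z)).comp
    (mfderivWithin 𝓘(ℝ, E) I (extChartAt I x).symm (range I) z)

/-- The exterior derivative of a 1-form, `dϑ (v, w) = D_v (ϑ w) - D_w (ϑ v)` in the preferred chart
at `x`; equivalently `dϑ (X, Y) = X (ϑ Y) - Y (ϑ X) - ϑ [X, Y]`. In the preferred chart at `x`
a vector of `TangentSpace I x` is its own coordinate vector. -/
def OneForm.d (ϑ : OneForm I M) (x : M) (v w : TangentSpace I x) : ℝ :=
  let D : E → E → ℝ := fun a b =>
    fderivWithin ℝ (ϑ.inChart x) (range I) (extChartAt I x x) a b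
  D v w - D w v

end OneForms

section Submanifolds

variable {E : Type*} [NormedAddCommGroup E] [NormedSpace ℝ E]
  {H : Type*} [TopologicalSpace H] (I : ModelWithCorners ℝ E H)
  {M : Type*} [TopologicalSpace M] [ChartedSpace H M]

/-- `S` is an embedded smooth submanifold of `M` of codimension `c` (not necessarily closed):
near each of its points it is the zero set of a smooth `ℝ^c`-valued map whose differential is
onto along `S`. A hypersurface is the case `c = 1`. -/
def IsEmbeddedSubmanifold (S : Set M) (c : ℕ) : Prop :=
  ∀ x ∈ S, ∃ U : Set M, IsOpen U ∧ x ∈ U ∧ ∃ g : M → (Fin c → ℝ),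
    ContMDiffOn I 𝓘(ℝ, Fin c → ℝ) ∞ g U ∧ S ∩ U = {y ∈ U | g y = 0} ∧
      ∀ y ∈ S ∩ U, Function.Surjective (mfderiv I 𝓘(ℝ, Fin c → ℝ) g y)

/-- The tangent space `T_x S` of a submanifold `S` of `M`: the velocities at `x` of the smooth
curves in `M` that pass through `x` at time `0` and stay in `S`. -/
def tangentSpaceOf (S : Set M) (x : M) : Set (TangentSpace I x) :=
  {v | ∃ γ : ℝ → M, ContMDiffAt 𝓘(ℝ, ℝ) I ∞ γ 0 ∧ (∀ᶠ t in 𝓝 (0 : ℝ), γ t ∈ S) ∧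
    (TotalSpace.mk (γ 0) (mfderiv 𝓘(ℝ, ℝ) I γ 0 (1 : ℝ)) : TangentBundle I M) =
      TotalSpace.mk x v}

variable {I}

/-- The subspace `{v ∈ T_x S | K v ∈ T_x S}` of a submanifold `S`, for a field `K` of
endomorphisms of the tangent spaces. -/
def invariantSubspace (K : ∀ x : M, TangentSpace I x → TangentSpace I x) (S : Set M) (x : M) :
    Set (TangentSpace I x) :=
  {v | v ∈ tangentSpaceOf I S x ∧ K x v ∈ tangentSpaceOf I S x}

/-- `S` is totally real with respect to `K`: its `K`-invariant subspaces are all trivial. -/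
def IsTotallyReal (K : ∀ x : M, TangentSpace I x → TangentSpace I x) (S : Set M) : Prop :=
  ∀ x ∈ S, invariantSubspace K S x = {0}

end Submanifolds

section AlmostComplexStructures

variable {E : Type*} [NormedAddCommGroup E] [NormedSpace ℝ E]
  {H : Type*} [TopologicalSpace H] (I : ModelWithCorners ℝ E H)
  (M : Type*) [TopologicalSpace M] [ChartedSpace H M] [IsManifold I ∞ M]

/-- An almost complex structure: a smooth field of endomorphisms `J` of the tangent spaces with
`J ∘ J = - id`. -/
structure AlmostComplexStructure where
  toFun : ∀ x : M, TangentSpace I x →L[ℝ] TangentSpace I x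
  smooth : ContMDiff I (I.prod 𝓘(ℝ, E →L[ℝ] E)) ∞
    (fun x => TotalSpace.mk' (E →L[ℝ] E) x (toFun x))
  sq_eq : ∀ (x : M) (v : TangentSpace I x), toFun x (toFun x v) = -v

instance : CoeFun (AlmostComplexStructure I M)
    (fun _ => ∀ x : M, TangentSpace I x →L[ℝ] TangentSpace I x) :=
  ⟨AlmostComplexStructure.toFun⟩

/-- The cotangent bundle `T^*M`; a point `α` is a pair of `α.proj : M` and the covector
`α.snd` at `α.proj`. -/
abbrev CotangentBundle : Type _ :=
  TotalSpace (E →L[ℝ] ℝ) (fun x : M => TangentSpace I x →L[ℝ] ℝ)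

/-- The model with corners of the cotangent bundle as a manifold. -/
abbrev cotangentModel : ModelWithCorners ℝ (E × (E →L[ℝ] ℝ)) (ModelProd H (E →L[ℝ] ℝ)) :=
  I.prod 𝓘(ℝ, E →L[ℝ] ℝ)

variable {I M}

namespace AlmostComplexStructure

variable (J : AlmostComplexStructure I M)

/-- The Nijenhuis tensor
`N (v, w) = [JX, JY] - [X, Y] - J ([X, JY] + [JX, Y])` at `x`, where `X`, `Y` are the fields
extending `v`, `w` that are constant in the preferred trivialization of `TM` at `x` (the value
does not depend on the choice of the extensions). -/
def nijenhuis (x : M) (v w : TangentSpace I x) : TangentSpace I x :=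
  let X : ∀ y : M, TangentSpace I y := FiberBundle.extend E v
  let Y : ∀ y : M, TangentSpace I y := FiberBundle.extend E w
  let JX : ∀ y : M, TangentSpace I y := fun y => J y (X y)
  let JY : ∀ y : M, TangentSpace I y := fun y => J y (Y y)
  VectorField.mlieBracket I JX JY x - VectorField.mlieBracket I X Y x
    - J x (VectorField.mlieBracket I X JY x + VectorField.mlieBracket I JX Y x)

/-- `J` is integrable: its Nijenhuis tensor vanishes identically. -/
def IsIntegrable : Prop :=
  ∀ (x : M) (v w : TangentSpace I x), J.nijenhuis x v w = 0

/-- The fibre `𝒟_x` of the `J`-invariant distribution of a hypersurface. -/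
def distribution (Γ : Set M) (x : M) : Set (TangentSpace I x) :=
  invariantSubspace (fun y v => J y v) Γ x

/-- `ϑ` is a defining 1-form on `Γ ∩ U` of the `J`-invariant distribution `𝒟` of `Γ`:
it is smooth and `ker (ϑ|_{T_y Γ}) = 𝒟_y` for all `y ∈ Γ ∩ U`. The 1-forms on the submanifold
`Γ` are locally the restrictions of the 1-forms on open sets of `M`, and `dϑ` on `T_y Γ`
depends on the restriction only. -/
def IsDefiningOneForm (Γ U : Set M) (ϑ : OneForm I M) : Prop :=
  ContMDiffOn I (cotangentModel I) ∞ (fun y => (TotalSpace.mk y (ϑ y) : CotangentBundle I M)) U ∧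
    ∀ y ∈ Γ ∩ U, ∀ v ∈ tangentSpaceOf I Γ y, ϑ y v = 0 ↔ v ∈ J.distribution Γ y

/-- The bilinear form `𝕃_x (v, w) = - dϑ_x (v, J w)`. -/
def leviBilinear (ϑ : OneForm I M) (x : M) (v w : TangentSpace I x) : ℝ :=
  -ϑ.d x v (J x w)

/-- The Levi form `ℒ_x (v) = - dϑ_x (v, J v)`. -/
def leviForm (ϑ : OneForm I M) (x : M) (v : TangentSpace I x) : ℝ :=
  J.leviBilinear ϑ x v v

/-- The symmetric part `(𝕃_x)^s` of `𝕃_x`. -/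
def leviSymm (ϑ : OneForm I M) (x : M) (v w : TangentSpace I x) : ℝ :=
  (1 / 2) * (J.leviBilinear ϑ x v w + J.leviBilinear ϑ x w v)

/-- The `J`-invariant distribution `𝒟` of `Γ` is a contact distribution: near every point of `Γ`
there is a defining 1-form `ϑ` of `𝒟` with `dϑ` non-degenerate on `𝒟` at that point. -/
def IsContact (Γ : Set M) : Prop :=
  ∀ x ∈ Γ, ∃ (U : Set M) (ϑ : OneForm I M), IsOpen U ∧ x ∈ U ∧ J.IsDefiningOneForm Γ U ϑ ∧
    ∀ v ∈ J.distribution Γ x, (∀ w ∈ J.distribution Γ x, ϑ.d x v w = 0) → v = 0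

/-- `Γ` is Levi non-degenerate: near every point of `Γ` there is a defining 1-form of `𝒟` for
which the symmetric part of `𝕃` is non-degenerate on `𝒟` at that point. -/
def IsLeviNondegenerate (Γ : Set M) : Prop :=
  ∀ x ∈ Γ, ∃ (U : Set M) (ϑ : OneForm I M), IsOpen U ∧ x ∈ U ∧ J.IsDefiningOneForm Γ U ϑ ∧
    ∀ v ∈ J.distribution Γ x, (∀ w ∈ J.distribution Γ x, J.leviSymm ϑ x v w = 0) → v = 0

/-- `Γ` is strongly pseudoconvex: near every point of `Γ` there is a defining 1-form of `𝒟` for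
which the Levi form is positive definite on `𝒟` at that point. -/
def IsStronglyPseudoconvex (Γ : Set M) : Prop :=
  ∀ x ∈ Γ, ∃ (U : Set M) (ϑ : OneForm I M), IsOpen U ∧ x ∈ U ∧ J.IsDefiningOneForm Γ U ϑ ∧
    ∀ v ∈ J.distribution Γ x, v ≠ 0 → 0 < J.leviForm ϑ x v

end AlmostComplexStructure

variable (I M)

/-- The projection `π_* : T_α (T^*M) → T_{π α} M`. -/
def cotangentProj (α : CotangentBundle I M) :
    TangentSpace (cotangentModel I) α →L[ℝ] TangentSpace I α.proj :=
  mfderiv (cotangentModel I) I (fun β : CotangentBundle I M => β.proj) α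

/-- The tautological 1-form `θ` of `T^*M`: `θ_α (V) = α (π_* V)`. -/
def tautologicalForm : OneForm (cotangentModel I) (CotangentBundle I M) :=
  fun α => α.snd.comp (cotangentProj I M α)

variable {I M}

/-- The canonical symplectic form `ω = dθ` of `T^*M`. -/
def symplecticForm (α : CotangentBundle I M) (V W : TangentSpace (cotangentModel I) α) : ℝ :=
  (tautologicalForm I M).d α V W

namespace AlmostComplexStructure

variable (J : AlmostComplexStructure I M)

/-- The fibre preserving map `Ĵ : T^*M → T^*M`, `Ĵ α = α ∘ J`. -/
def cotangentMap (α : CotangentBundle I M) : CotangentBundle I M :=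
  TotalSpace.mk α.proj (α.snd.comp (J α.proj))

/-- The tensor field `g^J_α (V, W) = ½ α (N (π_* V, J π_* W))` on `T^*M`. -/
def gTensor (α : CotangentBundle I M) (V W : TangentSpace (cotangentModel I) α) : ℝ :=
  (1 / 2) * α.snd (J.nijenhuis α.proj (cotangentProj I M α V)
    (J α.proj (cotangentProj I M α W)))

/-- The tensor field `ϖ^J = d (Ĵ^* θ) + g^J` on `T^*M`. -/
def varpi (α : CotangentBundle I M) (V W : TangentSpace (cotangentModel I) α) : ℝ :=
  (OneForm.pullback J.cotangentMap (tautologicalForm I M)).d α V W + J.gTensor α V W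

/-- The Ishihara-Yano lift `𝕁` of `J` to `T^*M`, `𝕁 V = ω⁻¹ (ϖ^J (V, ·), ·)`: the vector
`𝕁 V` is the one with `ω (𝕁 V, ·) = ϖ^J (V, ·)`, i.e. the inverse of `U ↦ ω (U, ·)` is applied
to `ϖ^J (V, ·)`. -/
def lift (α : CotangentBundle I M) (V : TangentSpace (cotangentModel I) α) :
    TangentSpace (cotangentModel I) α :=
  Function.invFun (fun U W => symplecticForm α U W) (fun W => J.varpi α V W)

end AlmostComplexStructure

/-- The conormal bundle of `Γ`: the covectors at points of `Γ` that vanish on `T Γ`. -/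
def conormalBundle (I : ModelWithCorners ℝ E H) (Γ : Set M) : Set (CotangentBundle I M) :=
  {α | α.proj ∈ Γ ∧ ∀ v ∈ tangentSpaceOf I Γ α.proj, α.snd v = 0}

variable (I M)

/-- The zero section of `T^*M`. -/
def zeroSection : Set (CotangentBundle I M) :=
  {α | α.snd = 0}

end AlmostComplexStructures

end AlmostComplex

end

/-! Everything is computed in the preferred chart at the point under consideration. Tangent vectors
become vectors of `E`, `J` an operator-valued function j, and Γ the set G = 0 with dG ≠ 0 along it.
The induced chart of T^*M has canonical coordinates (z, p), in which θ = p dz and Ĵ^*θ = p ∘ j.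
Hence ω(V, W) = V.2 W.1 - W.2 V.1, and solving ω(𝕁V, ·) = ϖ(V, ·) gives 𝕁V explicitly
(`lift_apply`).

A nonzero conormal covector is λ dG with λ ≠ 0. A vector V tangent to the conormal bundle there
satisfies dG(V.1) = 0 and V.2 = λ D²G(V.1, ·) on ker dG (`IsChartEquation.tangent_conormalBundle`).
If 𝕁V is tangent too, then v = V.1 lies in 𝒟. Comparing the two expressions for the covector part of
𝕁V on w ∈ 𝒟 and dividing by λ leaves d(dG ∘ J)(v, w) + ½ dG(N(v, Jw)) = 0. On 𝒟 the form dϑ is a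
nonzero multiple of d(dG ∘ J), for every defining form ϑ (`exists_exteriorDeriv_eq`). If N = 0, the
contact condition therefore forces v = 0. In the strongly pseudoconvex case take w = Jv: the N-term
is N(v, -v) = 0, so the Levi form vanishes at v and again v = 0. Now V is vertical, and V.2 and V.2
∘ J are both multiples of dG. Since dG and dG ∘ J are linearly independent, V = 0.

If N = 0, then d(dG ∘ J)(v, Jw) is symmetric in v and w (`dcomp_symm`), so 𝕃 is its own symmetric
part on 𝒟. As J maps 𝒟 onto itself, contact and Levi non-degenerate mean the same. The submanifold
statement uses no convexity: `conormalEquation` is a submersion into the dual of `E`, whose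
dimension is 2n. -/

noncomputable section

namespace AlmostComplex

/-! ### Derivatives of charts and tangent vectors in coordinates -/

section Charts

variable {E : Type*} [NormedAddCommGroup E] [NormedSpace ℝ E]
  {H : Type*} [TopologicalSpace H] (I : ModelWithCorners ℝ E H)
  {M : Type*} [TopologicalSpace M] [ChartedSpace H M]

/-- The derivative of the inverse of the preferred chart at `x`, as an endomorphism of the model
space. -/
def chartTangent (x : M) (z : E) : E →L[ℝ] E :=
  mfderivWithin 𝓘(ℝ, E) I (extChartAt I x).symm (range I) z

/-- The derivative of the preferred chart at `x`, as an endomorphism of the model space. -/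
def chartCotangent (x y : M) : E →L[ℝ] E :=
  mfderiv I 𝓘(ℝ, E) (extChartAt I x) y

variable {I}

/-- The value of a 1-form at a point, as a covector of the model space. -/
def OneForm.covector (ϑ : OneForm I M) (y : M) : E →L[ℝ] ℝ := ϑ y

theorem inChart_eq (ϑ : OneForm I M) (x : M) (z : E) :
    ϑ.inChart x z = (ϑ.covector ((extChartAt I x).symm z)).comp (chartTangent I x z) := rfl

theorem d_eq [I.Boundaryless] (ϑ : OneForm I M) (x : M) (v w : E) :
    ϑ.d x v w = fderiv ℝ (ϑ.inChart x) (extChartAt I x x) v w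
      - fderiv ℝ (ϑ.inChart x) (extChartAt I x x) w v := by
  simp only [OneForm.d, I.range_eq_univ, fderivWithin_univ]

variable [IsManifold I ∞ M]

theorem chartTangent_self (x : M) :
    chartTangent I x (extChartAt I x x) = ContinuousLinearMap.id ℝ E :=
  mfderivWithin_range_extChartAt_symm

theorem chartCotangent_comp_chartTangent {x : M} {z : E} (hz : z ∈ (extChartAt I x).target) :
    (chartCotangent I x ((extChartAt I x).symm z)).comp (chartTangent I x z)
      = ContinuousLinearMap.id ℝ E :=
  mfderiv_extChartAt_comp_mfderivWithin_extChartAt_symm hz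

theorem chartTangent_comp_chartCotangent {x : M} {z : E} (hz : z ∈ (extChartAt I x).target) :
    (chartTangent I x z).comp (chartCotangent I x ((extChartAt I x).symm z))
      = ContinuousLinearMap.id ℝ E :=
  mfderivWithin_extChartAt_symm_comp_mfderiv_extChartAt hz

theorem chartCotangent_chartTangent {x : M} {z : E} (hz : z ∈ (extChartAt I x).target) (u : E) :
    chartCotangent I x ((extChartAt I x).symm z) (chartTangent I x z u) = u :=
  DFunLike.congr_fun (chartCotangent_comp_chartTangent hz) u

theorem chartTangent_chartCotangent {x : M} {z : E} (hz : z ∈ (extChartAt I x).target) (u : E) :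
    chartTangent I x z (chartCotangent I x ((extChartAt I x).symm z) u) = u :=
  DFunLike.congr_fun (chartTangent_comp_chartCotangent hz) u

variable [I.Boundaryless]

theorem contMDiffAt_extChartAt_symm {x : M} {z : E} (hz : z ∈ (extChartAt I x).target) :
    ContMDiffAt 𝓘(ℝ, E) I ∞ (extChartAt I x).symm z :=
  (contMDiffOn_extChartAt_symm x z hz).contMDiffAt
    ((isOpen_extChartAt_target x).mem_nhds hz)

omit [IsManifold I ∞ M] in
theorem mfderiv_extChartAt_symm (x : M) (z : E) :
    mfderiv 𝓘(ℝ, E) I (extChartAt I x).symm z = chartTangent I x z := by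
  unfold chartTangent
  rw [I.range_eq_univ, mfderivWithin_univ]

/-- The tangent vectors of a submanifold, in the coordinates of a preferred chart. -/
theorem chartTangent_mem_tangentSpaceOf {S : Set M} {x : M} {z : E}
    (hz : z ∈ (extChartAt I x).target) (u : E) :
    (chartTangent I x z u : TangentSpace I ((extChartAt I x).symm z)) ∈
      tangentSpaceOf I S ((extChartAt I x).symm z) ↔
    ∃ c : ℝ → E, ContDiffAt ℝ ∞ c 0 ∧ c 0 = z ∧ HasDerivAt c u 0 ∧
      ∀ᶠ t in 𝓝 (0 : ℝ), (extChartAt I x).symm (c t) ∈ S := by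
  set φ := extChartAt I x with hφ
  constructor
  · rintro ⟨γ, hγ, hS, h⟩
    have h0 : γ 0 = φ.symm z := congrArg TotalSpace.proj h
    have hsrc : γ 0 ∈ φ.source := h0 ▸ φ.map_target hz
    have hφd : MDifferentiableAt I 𝓘(ℝ, E) φ (γ 0) :=
      mdifferentiableAt_extChartAt (by rwa [← extChartAt_source I])
    have hγd := hγ.mdifferentiableAt (by simp)
    have hc : ContDiffAt ℝ ∞ (φ ∘ γ) 0 := by
      refine ContMDiffAt.contDiffAt ?_
      exact (contMDiffAt_extChartAt' (by rwa [← extChartAt_source I])).comp (0 : ℝ) hγ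
    have hd := mfderiv_comp (0 : ℝ) hφd hγd
    refine ⟨φ ∘ γ, hc, by simp [h0, φ.right_inv hz], ?_, ?_⟩
    · have h1 := (hc.differentiableAt (by simp)).hasDerivAt
      convert h1
      rw [← fderiv_apply_one_eq_deriv, ← mfderiv_eq_fderiv, hd]
      -- Applying a function of the total space to `h` avoids transporting vectors between the
      -- tangent spaces at `γ 0` and at the given point.
      have h2 := congrArg (fun q : TangentBundle I M => chartCotangent I x q.1 q.2) h
      exact ((h2.trans (chartCotangent_chartTangent hz u))).symm
    · filter_upwards [hS, hγ.continuousAt.preimage_mem_nhds (extChartAt_source_mem_nhds' hsrc)]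
        with t ht ht'
      simpa [φ.left_inv ht'] using ht
  · rintro ⟨c, hc, h0, hu, hS⟩
    subst h0
    refine ⟨φ.symm ∘ c, (contMDiffAt_extChartAt_symm hz).comp 0 hc.contMDiffAt, hS, ?_⟩
    have h2 := mfderiv_comp (0 : ℝ) ((contMDiffAt_extChartAt_symm hz).mdifferentiableAt (by simp))
      hu.differentiableAt.mdifferentiableAt
    rw [h2]
    refine congrArg (TotalSpace.mk (φ.symm (c 0))) ?_
    rw [mfderiv_extChartAt_symm, mfderiv_eq_fderiv]
    refine congrArg (chartTangent I x (c 0)) ?_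
    rw [← hu.deriv]
    rfl

end Charts

/-! ### Canonical coordinates on the cotangent bundle -/

section Cotangent

variable {E : Type*} [NormedAddCommGroup E] [NormedSpace ℝ E]
  {H : Type*} [TopologicalSpace H] {I : ModelWithCorners ℝ E H}
  {M : Type*} [TopologicalSpace M] [ChartedSpace H M] [IsManifold I ∞ M]

/-- The covector underlying a point of the cotangent bundle, in the model space. -/
def covector (β : CotangentBundle I M) : E →L[ℝ] ℝ := β.snd

/-- The point of the cotangent bundle over `y` given by a covector of the model space. -/
def cotangentPoint (y : M) (p : E →L[ℝ] ℝ) : CotangentBundle I M := TotalSpace.mk y p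

/-- The trivialization of TM at `x` is the derivative of the chart, so that of T^*M is composition
with the derivative of the inverse chart. The bundle charts are thus the canonical coordinates (z,
p). -/
theorem trivialization_cotangent (x : M) (β : CotangentBundle I M)
    (hβ : β.proj ∈ (chartAt H x).source) :
    (trivializationAt (E →L[ℝ] ℝ) (fun y : M => TangentSpace I y →L[ℝ] ℝ) x β).2 =
      (covector β).comp (chartTangent I x (extChartAt I x β.proj)) := by
  change ContinuousLinearMap.inCoordinates E (TangentSpace I) ℝ (Bundle.Trivial M ℝ) x β.proj x
    β.proj β.snd = _
  rw [ContinuousLinearMap.inCoordinates, TangentBundle.symmL_trivializationAt hβ]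
  ext v
  simp
  rfl

theorem extChartAt_cotangent (α β : CotangentBundle I M)
    (hβ : β.proj ∈ (chartAt H α.proj).source) :
    extChartAt (cotangentModel I) α β = (extChartAt I α.proj β.proj,
      (covector β).comp (chartTangent I α.proj (extChartAt I α.proj β.proj))) := by
  rw [FiberBundle.extChartAt]
  rw [← trivialization_cotangent α.proj β hβ]
  rfl

theorem mem_extChartAt_cotangent_source (α β : CotangentBundle I M) :
    β ∈ (extChartAt (cotangentModel I) α).source ↔ β.proj ∈ (chartAt H α.proj).source := by
  rw [extChartAt_source, FiberBundle.chartedSpace_chartAt]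
  simp only [OpenPartialHomeomorph.trans_source, mem_inter_iff, mem_preimage]
  constructor
  · rintro ⟨_, h, _⟩
    exact h
  · intro h
    refine ⟨?_, h, mem_univ _⟩
    rw [Trivialization.mem_source, hom_trivializationAt_baseSet]
    exact ⟨h, mem_univ _⟩

theorem mem_extChartAt_cotangent_target (α : CotangentBundle I M) (q : E × (E →L[ℝ] ℝ)) :
    q ∈ (extChartAt (cotangentModel I) α).target ↔ q.1 ∈ (extChartAt I α.proj).target := by
  rw [FiberBundle.extChartAt_target]
  simp only [mem_prod, mem_inter_iff, mem_univ, and_true, and_iff_left_iff_imp]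
  intro h
  rw [mem_preimage, hom_trivializationAt_baseSet]
  refine ⟨?_, mem_univ _⟩
  have := (extChartAt I α.proj).map_target h
  rwa [extChartAt_source] at this

theorem extChartAt_cotangent_symm (α : CotangentBundle I M) {z : E} (p : E →L[ℝ] ℝ)
    (hz : z ∈ (extChartAt I α.proj).target) :
    (extChartAt (cotangentModel I) α).symm (z, p) = cotangentPoint ((extChartAt I α.proj).symm z)
      (p.comp (chartCotangent I α.proj ((extChartAt I α.proj).symm z))) := by
  have hsrc := (extChartAt I α.proj).map_target hz
  rw [extChartAt_source] at hsrc
  set β : CotangentBundle I M := cotangentPoint ((extChartAt I α.proj).symm z)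
      (p.comp (chartCotangent I α.proj ((extChartAt I α.proj).symm z))) with hβ
  have h := extChartAt_cotangent α β hsrc
  have h1 : extChartAt I α.proj β.proj = z := (extChartAt I α.proj).right_inv hz
  rw [h1] at h
  have h2 : (covector β).comp (chartTangent I α.proj z) = p := by
    ext u
    exact congrArg p (chartCotangent_chartTangent hz u)
  rw [h2] at h
  rw [← h]
  exact (extChartAt (cotangentModel I) α).left_inv
    ((mem_extChartAt_cotangent_source α β).2 hsrc)

theorem extChartAt_cotangent_self (α : CotangentBundle I M) :
    extChartAt (cotangentModel I) α α = (extChartAt I α.proj α.proj, covector α) := by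
  rw [extChartAt_cotangent α α (mem_chart_source H α.proj), chartTangent_self]
  rfl

end Cotangent

/-! ### The forms θ, ω and d(Ĵ^*θ) in canonical coordinates -/

section Lifts

variable {E : Type*} [NormedAddCommGroup E] [NormedSpace ℝ E]
  {H : Type*} [TopologicalSpace H] {I : ModelWithCorners ℝ E H}
  {M : Type*} [TopologicalSpace M] [ChartedSpace H M] [IsManifold I ∞ M]

/-- The value of an almost complex structure at a point, as an endomorphism of the model space. -/
def AlmostComplexStructure.endo (J : AlmostComplexStructure I M) (y : M) : E →L[ℝ] E := J y

/-- An almost complex structure in the coordinates of the preferred chart at `x`. -/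
def AlmostComplexStructure.inChart (J : AlmostComplexStructure I M) (x : M) (z : E) : E →L[ℝ] E :=
  (chartCotangent I x ((extChartAt I x).symm z)).comp
    ((J.endo ((extChartAt I x).symm z)).comp (chartTangent I x z))

variable (J : AlmostComplexStructure I M)

theorem chartTangent_inChart {x : M} {z : E} (hz : z ∈ (extChartAt I x).target) (u : E) :
    chartTangent I x z (J.inChart x z u) =
      J.endo ((extChartAt I x).symm z) (chartTangent I x z u) :=
  chartTangent_chartCotangent hz _

theorem endo_endo (y : M) (u : E) : J.endo y (J.endo y u) = -u := J.sq_eq y u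

theorem inChart_inChart {x : M} {z : E} (hz : z ∈ (extChartAt I x).target) (u : E) :
    J.inChart x z (J.inChart x z u) = -u := by
  have : chartTangent I x z (J.inChart x z (J.inChart x z u)) = chartTangent I x z (-u) := by
    rw [chartTangent_inChart J hz, chartTangent_inChart J hz, endo_endo, map_neg]
  have h := congrArg (chartCotangent I x ((extChartAt I x).symm z)) this
  rwa [chartCotangent_chartTangent hz, chartCotangent_chartTangent hz] at h

theorem inChart_self (x : M) : J.inChart x (extChartAt I x x) = J.endo x := by
  have hz := mem_extChartAt_target (I := I) x
  ext u
  have h := chartTangent_inChart J hz u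
  rw [chartTangent_self] at h
  simpa [extChartAt_to_inv] using h

theorem contMDiffAt_inChart (x : M) :
    ContMDiffAt I 𝓘(ℝ, E →L[ℝ] E) ∞ (fun y => J.inChart x (extChartAt I x y)) x := by
  have h := ((contMDiffAt_hom_bundle _).1 (J.smooth x)).2
  refine h.congr_of_eventuallyEq ?_
  filter_upwards [extChartAt_source_mem_nhds (I := I) x] with y hy
  have hy' := hy
  rw [extChartAt_source] at hy'
  change _ = ContinuousLinearMap.inCoordinates E (TangentSpace I) E (TangentSpace I) x y x y (J y)
  rw [ContinuousLinearMap.inCoordinates, TangentBundle.symmL_trivializationAt hy',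
    TangentBundle.continuousLinearMapAt_trivializationAt hy']
  unfold AlmostComplexStructure.inChart
  rw [(extChartAt I x).left_inv hy]
  rfl

theorem contDiffAt_inChart [I.Boundaryless] (x : M) :
    ContDiffAt ℝ ∞ (J.inChart x) (extChartAt I x x) := by
  have hz := mem_extChartAt_target (I := I) x
  refine ContMDiffAt.contDiffAt ?_
  have h := (contMDiffAt_inChart J x)
  have h2 := h.comp_of_eq (contMDiffAt_extChartAt_symm hz) (extChartAt_to_inv x)
  refine h2.congr_of_eventuallyEq ?_
  filter_upwards [extChartAt_target_mem_nhds (I := I) x] with z hz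
  exact (congrArg (J.inChart x) ((extChartAt I x).right_inv hz)).symm

theorem covector_cotangentMap (β : CotangentBundle I M) :
    covector (J.cotangentMap β) = (covector β).comp (J.endo β.proj) := rfl

theorem contMDiffAt_trivialization_snd (β : CotangentBundle I M) :
    ContMDiffAt (cotangentModel I) 𝓘(ℝ, E →L[ℝ] ℝ) ∞ (fun β' : CotangentBundle I M =>
      (trivializationAt (E →L[ℝ] ℝ) (fun y : M => TangentSpace I y →L[ℝ] ℝ) β.proj β').2) β :=
  (contMDiffAt_totalSpace.1 (contMDiffAt_id (x := β))).2

/-- In canonical coordinates the map is (z, p) ↦ (z, p ∘ j(z)). Differentiability is what lets the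
chain rule compute the pull-back of θ. -/
theorem contMDiffAt_cotangentMap (β : CotangentBundle I M) :
    ContMDiffAt (cotangentModel I) (cotangentModel I) ∞ J.cotangentMap β := by
  refine contMDiffAt_totalSpace.2 ⟨contMDiffAt_proj _, ?_⟩
  have h1 := contMDiffAt_trivialization_snd β
  have h2 : ContMDiffAt (cotangentModel I) 𝓘(ℝ, E →L[ℝ] E) ∞
      (fun β' : CotangentBundle I M => J.inChart β.proj (extChartAt I β.proj β'.proj)) β :=
    (contMDiffAt_inChart J β.proj).comp β (contMDiffAt_proj _)
  have h3 := h1.clm_comp h2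
  refine h3.congr_of_eventuallyEq ?_
  have hs : ∀ᶠ β' in 𝓝 β, β' ∈ (extChartAt (cotangentModel I) β).source :=
    extChartAt_source_mem_nhds (I := cotangentModel I) β
  filter_upwards [hs] with β' hβ'
  rw [mem_extChartAt_cotangent_source] at hβ'
  rw [trivialization_cotangent _ _ hβ']
  refine (trivialization_cotangent β.proj (J.cotangentMap β') hβ').trans ?_
  rw [covector_cotangentMap]
  ext u
  have hβ'' := hβ'
  rw [← extChartAt_source I] at hβ''
  have h := chartTangent_inChart J ((extChartAt I β.proj).map_source hβ'') u
  simp only [(extChartAt I β.proj).left_inv hβ''] at h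
  simp only [ContinuousLinearMap.comp_apply]
  rw [h]
  rfl

variable [I.Boundaryless]

omit [I.Boundaryless] in
/-- The differential of the projection of the cotangent bundle, as a map of the model spaces. -/
def projDeriv (β : CotangentBundle I M) : E × (E →L[ℝ] ℝ) →L[ℝ] E := cotangentProj I M β

theorem projDeriv_chartTangent (α : CotangentBundle I M) {z : E} (p : E →L[ℝ] ℝ)
    (hz : z ∈ (extChartAt I α.proj).target) (u : E × (E →L[ℝ] ℝ)) :
    projDeriv ((extChartAt (cotangentModel I) α).symm (z, p))
      (chartTangent (cotangentModel I) α (z, p) u) = chartTangent I α.proj z u.1 := by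
  set Ψ := extChartAt (cotangentModel I) α with hΨ
  have hq : (z, p) ∈ Ψ.target := (mem_extChartAt_cotangent_target α (z, p)).2 hz
  have hΨd : MDifferentiableAt 𝓘(ℝ, E × (E →L[ℝ] ℝ)) (cotangentModel I) Ψ.symm (z, p) :=
    (contMDiffAt_extChartAt_symm hq).mdifferentiableAt (by simp)
  have hproj : MDifferentiableAt (cotangentModel I) I
      (fun β : CotangentBundle I M => β.proj) (Ψ.symm (z, p)) :=
    (contMDiffAt_proj _ (n := ∞)).mdifferentiableAt (by simp)
  have h2 := mfderiv_comp (z, p) hproj hΨd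
  have h3 : (fun β : CotangentBundle I M => β.proj) ∘ Ψ.symm =ᶠ[𝓝 (z, p)]
      (extChartAt I α.proj).symm ∘ Prod.fst := by
    filter_upwards [(isOpen_extChartAt_target α).mem_nhds hq] with q hq'
    have := (mem_extChartAt_cotangent_target α q).1 hq'
    simp only [Function.comp]
    rw [hΨ, ← Prod.mk.eta (p := q), extChartAt_cotangent_symm α q.2 this]
    rfl
  have h4 := h3.mfderiv_eq (I := 𝓘(ℝ, E × (E →L[ℝ] ℝ))) (I' := I)
  have h5 := mfderiv_comp (z, p) (f := (Prod.fst : E × (E →L[ℝ] ℝ) → E))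
    (I := 𝓘(ℝ, E × (E →L[ℝ] ℝ))) (I' := 𝓘(ℝ, E))
    ((contMDiffAt_extChartAt_symm hz).mdifferentiableAt (by simp))
    differentiableAt_fst.mdifferentiableAt
  rw [mfderiv_extChartAt_symm, mfderiv_eq_fderiv, fderiv_fst] at h5
  have h6 := DFunLike.congr_fun (h2.symm.trans (h4.trans h5)) u
  rw [mfderiv_extChartAt_symm] at h6
  exact h6

/-- For a fibre preserving f one has π ∘ f = π, so (f^*θ)_β = f(β) ∘ π_*, with no derivative of f
left. It is used for f = id and f = Ĵ. -/
theorem inChart_pullback_tautologicalForm (α : CotangentBundle I M)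
    (f : CotangentBundle I M → CotangentBundle I M) (hf : ∀ β, (f β).proj = β.proj)
    (hf' : ∀ β, MDifferentiableAt (cotangentModel I) (cotangentModel I) f β)
    {z : E} (p : E →L[ℝ] ℝ) (hz : z ∈ (extChartAt I α.proj).target) (u : E × (E →L[ℝ] ℝ)) :
    (OneForm.pullback (I := cotangentModel I) (I' := cotangentModel I) f
      (tautologicalForm I M)).inChart α (z, p) u =
      covector (f ((extChartAt (cotangentModel I) α).symm (z, p)))
        (chartTangent I α.proj z u.1) := by
  rw [← projDeriv_chartTangent α p hz u]
  set β := (extChartAt (cotangentModel I) α).symm (z, p) with hβ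
  have hproj : MDifferentiableAt (cotangentModel I) I
      (fun β : CotangentBundle I M => β.proj) (f β) :=
    (contMDiffAt_proj _ (n := ∞)).mdifferentiableAt (by simp)
  have h1 := mfderiv_comp β hproj (hf' β)
  have h2 : (fun β : CotangentBundle I M => β.proj) ∘ f = fun β => β.proj := funext hf
  -- The codomain of the differential depends on the map, so equal maps are substituted for
  -- variables rather than rewritten.
  have h3 : ∀ g h : CotangentBundle I M → M, g = h → ∀ w : E × (E →L[ℝ] ℝ),
      (mfderiv (cotangentModel I) I g β w : E) = mfderiv (cotangentModel I) I h β w := by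
    rintro g _ rfl w
    rfl
  have h4 := DFunLike.congr_fun h1 (chartTangent (cotangentModel I) α (z, p) u)
  exact congrArg (covector (f β)) (h4.symm.trans (h3 _ _ h2 _))

theorem inChart_tautologicalForm (α : CotangentBundle I M)
    {z : E} (p : E →L[ℝ] ℝ) (hz : z ∈ (extChartAt I α.proj).target) (u : E × (E →L[ℝ] ℝ)) :
    (tautologicalForm I M).inChart α (z, p) u = p u.1 := by
  have h := inChart_pullback_tautologicalForm α id (fun _ => rfl) (fun _ => mdifferentiableAt_id)
    p hz u
  have h1 : OneForm.pullback (I := cotangentModel I) (I' := cotangentModel I) id (tautologicalForm I M) = tautologicalForm I M := by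
    funext β
    simp only [OneForm.pullback, mfderiv_id]
    rfl
  rw [h1] at h
  rw [h, id, extChartAt_cotangent_symm α p hz]
  exact congrArg p (chartCotangent_chartTangent hz u.1)

theorem inChart_pullback_cotangentMap (α : CotangentBundle I M)
    {z : E} (p : E →L[ℝ] ℝ) (hz : z ∈ (extChartAt I α.proj).target) (u : E × (E →L[ℝ] ℝ)) :
    (OneForm.pullback (I := cotangentModel I) (I' := cotangentModel I) J.cotangentMap (tautologicalForm I M)).inChart α (z, p) u =
      p (J.inChart α.proj z u.1) := by
  rw [inChart_pullback_tautologicalForm α J.cotangentMap (fun _ => rfl)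
    (fun β => (contMDiffAt_cotangentMap J β).mdifferentiableAt (by simp)) p hz u,
    extChartAt_cotangent_symm α p hz, covector_cotangentMap]
  rfl

theorem symplecticForm_apply (α : CotangentBundle I M) (V W : E × (E →L[ℝ] ℝ)) :
    symplecticForm α V W = V.2 W.1 - W.2 V.1 := by
  have hz := mem_extChartAt_target (I := I) α.proj
  set z₀ := extChartAt I α.proj α.proj with hz₀
  have key : ∀ V W : E × (E →L[ℝ] ℝ),
      fderiv ℝ ((tautologicalForm I M).inChart α) (z₀, covector α) V W = V.2 W.1 := by
    have h : HasFDerivAt ((tautologicalForm I M).inChart α)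
      (((ContinuousLinearMap.compL ℝ (E × (E →L[ℝ] ℝ)) E ℝ).flip
        (ContinuousLinearMap.fst ℝ E (E →L[ℝ] ℝ))).comp
        (ContinuousLinearMap.snd ℝ E (E →L[ℝ] ℝ))) (z₀, covector α) := by
      refine (ContinuousLinearMap.hasFDerivAt _).congr_of_eventuallyEq ?_
      filter_upwards [(continuous_fst.tendsto (z₀, covector α)).eventually
        (extChartAt_target_mem_nhds (I := I) α.proj)] with q hq
      refine ContinuousLinearMap.ext fun u => ?_
      exact inChart_tautologicalForm α q.2 hq u
    intro V W
    rw [h.fderiv]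
    rfl
  refine (d_eq (E := E × (E →L[ℝ] ℝ)) (tautologicalForm I M) α V W).trans ?_
  rw [extChartAt_cotangent_self, key, key]

theorem d_pullback_cotangentMap (α : CotangentBundle I M) (V W : E × (E →L[ℝ] ℝ)) :
    (OneForm.pullback (I := cotangentModel I) (I' := cotangentModel I) J.cotangentMap (tautologicalForm I M)).d α V W =
      (V.2 (J.endo α.proj W.1) - W.2 (J.endo α.proj V.1)) +
      covector α (fderiv ℝ (J.inChart α.proj) (extChartAt I α.proj α.proj) V.1 W.1
        - fderiv ℝ (J.inChart α.proj) (extChartAt I α.proj α.proj) W.1 V.1) := by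
  have hz := mem_extChartAt_target (I := I) α.proj
  set z₀ := extChartAt I α.proj α.proj with hz₀
  have hJ := ((contDiffAt_inChart J α.proj).differentiableAt (by simp)).hasFDerivAt
  rw [← hz₀] at hJ
  have key : ∀ V W : E × (E →L[ℝ] ℝ), fderiv ℝ
      ((OneForm.pullback (I := cotangentModel I) (I' := cotangentModel I) J.cotangentMap (tautologicalForm I M)).inChart α) (z₀, covector α) V W =
        V.2 (J.endo α.proj W.1) + covector α (fderiv ℝ (J.inChart α.proj) z₀ V.1 W.1) := by
    have h := ((hasFDerivAt_snd (𝕜 := ℝ) (p := (z₀, covector α))).clm_comp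
      (hJ.comp (z₀, covector α) hasFDerivAt_fst)).clm_comp
        (hasFDerivAt_const (ContinuousLinearMap.fst ℝ E (E →L[ℝ] ℝ)) (z₀, covector α))
    have h' := h.congr_of_eventuallyEq (f₁ :=
      (OneForm.pullback (I := cotangentModel I) (I' := cotangentModel I) J.cotangentMap (tautologicalForm I M)).inChart α) (by
        filter_upwards [(continuous_fst.tendsto (z₀, covector α)).eventually
          (extChartAt_target_mem_nhds (I := I) α.proj)] with q hq
        refine ContinuousLinearMap.ext fun u => ?_
        exact inChart_pullback_cotangentMap J α q.2 hq u)
    intro V W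
    rw [h'.fderiv, ← inChart_self]
    simp [add_comm, hz₀]
  rw [d_eq (E := E × (E →L[ℝ] ℝ)), extChartAt_cotangent_self, ← hz₀, key, key, map_sub]
  ring

end Lifts

/-! ### The Nijenhuis tensor and the Ishihara–Yano lift in coordinates -/

section Nijenhuis

variable {E : Type*} [NormedAddCommGroup E] [NormedSpace ℝ E]
  {H : Type*} [TopologicalSpace H] {I : ModelWithCorners ℝ E H}
  {M : Type*} [TopologicalSpace M] [ChartedSpace H M] [IsManifold I ∞ M]

/-- The vector field that is constant in the preferred trivialization at `x`. -/
def constField (I : ModelWithCorners ℝ E H) [IsManifold I ∞ M] (x : M) (v : TangentSpace I x) :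
    ∀ y : M, TangentSpace I y :=
  FiberBundle.extend E v

/-- The extensions chosen in `nijenhuis` are constant in the chart, so brackets of them and of their
images under `J` involve only the first derivative of j. -/
theorem constField_chart {x : M} (v : E) {z : E} (hz : z ∈ (extChartAt I x).target) :
    constField I x v ((extChartAt I x).symm z) =
      chartTangent I x z v := by
  have hsrc := (extChartAt I x).map_target hz
  rw [extChartAt_source] at hsrc
  have h1 := TangentBundle.symmL_trivializationAt (I := I) hsrc
  rw [(extChartAt I x).right_inv hz] at h1
  have h2 : ((trivializationAt E (TangentSpace I) x) ⟨x, (v : TangentSpace I x)⟩).2 = v := by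
    have h3 := TangentBundle.continuousLinearMapAt_trivializationAt (I := I) (mem_chart_source H x)
    rw [mfderiv_extChartAt_self] at h3
    have h4 := DFunLike.congr_fun h3 (v : TangentSpace I x)
    refine Eq.trans (congrFun (Trivialization.coe_linearMapAt_of_mem (R := ℝ) _ ?_) _).symm h4
    exact FiberBundle.mem_baseSet_trivializationAt' x
  have h5 := DFunLike.congr_fun h1 v
  unfold constField FiberBundle.extend
  rw [h2]
  refine Eq.trans (Trivialization.symmL_apply _ ?_ v).symm h5
  exact hsrc

variable [I.Boundaryless]

theorem mpullbackWithin_extChartAt_symm {x : M} (X : ∀ y : M, TangentSpace I y) (c : E → E)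
    (h : ∀ z ∈ (extChartAt I x).target, X ((extChartAt I x).symm z) = chartTangent I x z (c z)) :
    (VectorField.mpullbackWithin 𝓘(ℝ, E) I (extChartAt I x).symm X (range I) : E → E)
      =ᶠ[𝓝 (extChartAt I x x)] c := by
  filter_upwards [extChartAt_target_mem_nhds (I := I) x] with z hz
  have h1 : (chartTangent I x z).inverse = chartCotangent I x ((extChartAt I x).symm z) :=
    ContinuousLinearMap.inverse_eq (chartTangent_comp_chartCotangent hz)
      (chartCotangent_comp_chartTangent hz)
  have h2 := chartCotangent_chartTangent hz (c z)
  rw [← h1, ← h z hz] at h2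
  exact h2

omit [I.Boundaryless] in
theorem lieBracketWithin_univ_congr {a b c d : E → E} {z : E} (h1 : a =ᶠ[𝓝 z] c)
    (h2 : b =ᶠ[𝓝 z] d) :
    VectorField.lieBracketWithin ℝ a b univ z = fderiv ℝ d z (c z) - fderiv ℝ c z (d z) := by
  rw [VectorField.lieBracketWithin_univ, VectorField.lieBracket, h1.fderiv_eq, h2.fderiv_eq,
    h1.eq_of_nhds, h2.eq_of_nhds]

/-- The bracket is computed after pulling back to the chart, and at the centre of the chart the
derivative of the chart is the identity. -/
theorem mlieBracket_eq {x : M} (X Y : ∀ y : M, TangentSpace I y) (c d : E → E)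
    (hX : ∀ z ∈ (extChartAt I x).target, X ((extChartAt I x).symm z) = chartTangent I x z (c z))
    (hY : ∀ z ∈ (extChartAt I x).target, Y ((extChartAt I x).symm z) = chartTangent I x z (d z)) :
    (VectorField.mlieBracket I X Y x : E) =
      fderiv ℝ d (extChartAt I x x) (c (extChartAt I x x)) -
        fderiv ℝ c (extChartAt I x x) (d (extChartAt I x x)) := by
  have h1 := mpullbackWithin_extChartAt_symm X c hX
  have h2 := mpullbackWithin_extChartAt_symm Y d hY
  have h0 : (chartCotangent I x x).inverse = ContinuousLinearMap.id ℝ E :=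
    (congrArg ContinuousLinearMap.inverse (mfderiv_extChartAt_self (I := I) (x := x))).trans
      (ContinuousLinearMap.inverse_id (R := ℝ) (M := E))
  have h3 : (VectorField.mlieBracket I X Y x : E) = (chartCotangent I x x).inverse _ :=
    VectorField.mlieBracketWithin_apply (I := I) (V := X) (W := Y) (s := univ) (x₀ := x)
  rw [h0] at h3
  refine (h3.trans (?_ : _ = VectorField.lieBracketWithin ℝ (V :=
    (VectorField.mpullbackWithin 𝓘(ℝ, E) I (extChartAt I x).symm X (range I) : E → E))
     (VectorField.mpullbackWithin 𝓘(ℝ, E) I (extChartAt I x).symm Y (range I) : E → E)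
     univ (extChartAt I x x))).trans ?_
  · simp only [preimage_univ, univ_inter]
    rw [I.range_eq_univ]
    rfl
  · exact lieBracketWithin_univ_congr (E := E) h1 h2

variable (J : AlmostComplexStructure I M)

theorem nijenhuis_eq (x : M) (v w : E) :
    (J.nijenhuis x v w : E) =
      fderiv ℝ (J.inChart x) (extChartAt I x x) (J.endo x v) w
        - fderiv ℝ (J.inChart x) (extChartAt I x x) (J.endo x w) v
        - J.endo x (fderiv ℝ (J.inChart x) (extChartAt I x x) v w
          - fderiv ℝ (J.inChart x) (extChartAt I x x) w v) := by
  set z₀ := extChartAt I x x with hz₀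
  have hJ := ((contDiffAt_inChart J x).differentiableAt (by simp))
  have hd : ∀ u : E, fderiv ℝ (fun z => J.inChart x z u) z₀ =
      (fderiv ℝ (J.inChart x) z₀).flip u := by
    intro u
    have := (hJ.hasFDerivAt.clm_apply (hasFDerivAt_const u _)).fderiv
    rw [this]
    simp [hz₀]
  have hX : ∀ u : E, ∀ z ∈ (extChartAt I x).target,
      constField I x u ((extChartAt I x).symm z)
        = chartTangent I x z ((fun _ => u) z) := fun u z hz => constField_chart u hz
  have hJX : ∀ u : E, ∀ z ∈ (extChartAt I x).target,
      J ((extChartAt I x).symm z) (constField I x u ((extChartAt I x).symm z))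
        = chartTangent I x z ((fun z => J.inChart x z u) z) := by
    intro u z hz
    refine Eq.trans ?_ (chartTangent_inChart J hz u).symm
    rw [constField_chart u hz]
    rfl
  let X : E → ∀ y : M, TangentSpace I y := fun u => constField I x u
  let JX : E → ∀ y : M, TangentSpace I y := fun u y => J y (X u y)
  have e1 := mlieBracket_eq (JX v) (JX w) _ _ (hJX v) (hJX w)
  have e2 := mlieBracket_eq (X v) (X w) _ _ (hX v) (hX w)
  have e3 := mlieBracket_eq (X v) (JX w) _ _ (hX v) (hJX w)
  have e4 := mlieBracket_eq (JX v) (X w) _ _ (hJX v) (hX w)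
  rw [← hz₀, hd, hd] at e1
  rw [← hz₀, hd] at e3 e4
  simp only [inChart_self, hz₀, ContinuousLinearMap.flip_apply, fderiv_fun_const, Pi.zero_apply,
    zero_apply, sub_zero, zero_sub] at e1 e2 e3 e4
  rw [← hz₀] at e3 e4
  have key : ∀ a a' b b' c c' d d' : E, a = a' → b = b' → c = c' → d = d' →
     a - b - J.endo x (c + d) = a' - b' - J.endo x (c' + d') := by
    rintro _ _ _ _ _ _ _ _ rfl rfl rfl rfl; rfl
  refine (key _ _ _ _ _ _ _ _ e1 e2 e3 e4).trans ?_
  rw [sub_zero, ← sub_eq_add_neg]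

/-- The Nijenhuis tensor as a continuous bilinear map of the model space. -/
def AlmostComplexStructure.nijenhuisBilin (x : M) : E →L[ℝ] E →L[ℝ] E :=
  let D := fderiv ℝ (J.inChart x) (extChartAt I x x)
  D.comp (J.endo x) - (D.comp (J.endo x)).flip
    - (ContinuousLinearMap.compL ℝ E E E (J.endo x)).comp (D - D.flip)

theorem nijenhuis_eq_bilin (x : M) (v w : E) :
    (J.nijenhuis x v w : E) = J.nijenhuisBilin x v w := by
  rw [nijenhuis_eq]
  rfl

omit [I.Boundaryless] in
theorem nijenhuisBilin_self (x : M) (v : E) : J.nijenhuisBilin x v v = 0 := by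
  simp [AlmostComplexStructure.nijenhuisBilin]

theorem cotangentProj_apply (α : CotangentBundle I M) (V : E × (E →L[ℝ] ℝ)) :
    (cotangentProj I M α V : E) = V.1 := by
  have h := projDeriv_chartTangent α (covector α) (mem_extChartAt_target (I := I) α.proj) V
  rw [← extChartAt_cotangent_self, chartTangent_self, chartTangent_self, extChartAt_to_inv] at h
  exact h

theorem varpi_apply (α : CotangentBundle I M) (V W : E × (E →L[ℝ] ℝ)) :
    J.varpi α V W = V.2 (J.endo α.proj W.1) - W.2 (J.endo α.proj V.1) +
      covector α (fderiv ℝ (J.inChart α.proj) (extChartAt I α.proj α.proj) V.1 W.1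
        - fderiv ℝ (J.inChart α.proj) (extChartAt I α.proj α.proj) W.1 V.1) +
      (1 / 2) * covector α (J.nijenhuisBilin α.proj V.1 (J.endo α.proj W.1)) := by
  have h1 := d_pullback_cotangentMap J α V W
  have h2 : J.gTensor α V W =
      (1 / 2) * covector α (J.nijenhuisBilin α.proj V.1 (J.endo α.proj W.1)) := by
    rw [← nijenhuis_eq_bilin, ← cotangentProj_apply α V, ← cotangentProj_apply α W]
    rfl
  exact congrArg₂ (· + ·) h1 h2

/-- The covector component of the Ishihara-Yano lift. -/
def AlmostComplexStructure.liftCovector (α : CotangentBundle I M) (V : E × (E →L[ℝ] ℝ)) :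
    E →L[ℝ] ℝ :=
  let D := fderiv ℝ (J.inChart α.proj) (extChartAt I α.proj α.proj)
  V.2.comp (J.endo α.proj) + (covector α).comp (D V.1 - D.flip V.1) +
    (1 / 2 : ℝ) • (covector α).comp ((J.nijenhuisBilin α.proj V.1).comp (J.endo α.proj))

/-- The right-hand side solves the equation defining 𝕁V, and the solution is unique because ω is
non-degenerate. -/
theorem lift_apply (α : CotangentBundle I M) (V : E × (E →L[ℝ] ℝ)) :
    (J.lift α V : E × (E →L[ℝ] ℝ)) = (J.endo α.proj V.1, J.liftCovector α V) := by
  have hsol : (fun W : E × (E →L[ℝ] ℝ) => symplecticForm α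
      ((J.endo α.proj V.1, J.liftCovector α V) : E × (E →L[ℝ] ℝ)) W) =
        fun W => J.varpi α V W := by
    funext W
    rw [varpi_apply]
    refine (symplecticForm_apply α (J.endo α.proj V.1, J.liftCovector α V) W).trans ?_
    simp [AlmostComplexStructure.liftCovector]
    ring
  -- `Function.invFun` takes a default value off the range, so the explicit solution is needed
  -- before 𝕁V is known to satisfy its equation.
  have h := Function.invFun_eq (f := fun U W => symplecticForm α U W)
    (b := fun W => J.varpi α V W) ⟨_, hsol⟩
  set U : E × (E →L[ℝ] ℝ) := J.lift α V with hU
  have h1 : ∀ W : E × (E →L[ℝ] ℝ), U.2 W.1 - W.2 U.1 =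
      J.liftCovector α V W.1 - W.2 (J.endo α.proj V.1) := by
    intro W
    refine (symplecticForm_apply α U W).symm.trans ?_
    refine Eq.trans ?_ (symplecticForm_apply α (J.endo α.proj V.1, J.liftCovector α V) W)
    exact (congrFun h W).trans (congrFun hsol W).symm
  refine Prod.ext ?_ ?_
  -- Vertical test vectors (0, q) determine the base component, since functionals separate points;
  -- horizontal ones (u, 0) determine the covector.
  · refine (SeparatingDual.eq_iff_forall_dual_eq (R := ℝ)).2 fun q => ?_
    simpa using h1 (0, q)
  · ext u
    simpa using h1 (u, 0)

end Nijenhuis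

/-! ### Curves in a level set -/

section Calculus

variable {E : Type*} [NormedAddCommGroup E] [NormedSpace ℝ E]

/-- A vector annihilated by the differential of a submersion is the velocity of a smooth curve in
the level set. -/
theorem exists_curve_in_zero_set [CompleteSpace E] {G : E → ℝ} {z u : E} (hG : ContDiffAt ℝ ∞ G z)
    (hz : G z = 0) (hne : fderiv ℝ G z ≠ 0) (hu : fderiv ℝ G z u = 0) :
    ∃ c : ℝ → E, ContDiffAt ℝ ∞ c 0 ∧ c 0 = z ∧ HasDerivAt c u 0 ∧
      ∀ᶠ t in 𝓝 (0 : ℝ), G (c t) = 0 := by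
  obtain ⟨e', he'⟩ := DFunLike.ne_iff.1 hne
  obtain ⟨e, he⟩ : ∃ e, fderiv ℝ G z e = 1 := by
    refine ⟨(fderiv ℝ G z e')⁻¹ • e', ?_⟩
    rw [map_smul, smul_eq_mul, inv_mul_cancel₀ he']
  -- With dG_z(e) = 1 this gives dG_z(Φ y - z) = G y, while DΦ = id at z. The local inverse ψ
  -- therefore carries the hyperplane z + ker dG_z into the level set, and the curve is the image of
  -- the line z + tu.
  set Φ : E → E := fun y => y + (G y - fderiv ℝ G z (y - z)) • e with hΦ
  have hΦz : Φ z = z := by simp [hΦ, hz]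
  have hΦs : ContDiffAt ℝ ∞ Φ z :=
    contDiffAt_id.add ((hG.sub ((fderiv ℝ G z).contDiff.contDiffAt.comp z
      (contDiffAt_id.sub contDiffAt_const))).smul contDiffAt_const)
  have hΦd : HasFDerivAt Φ ((ContinuousLinearEquiv.refl ℝ E : E ≃L[ℝ] E) : E →L[ℝ] E) z := by
    have h1 := (hG.differentiableAt (by simp)).hasFDerivAt
    have h2 := (hasFDerivAt_id z).add ((h1.sub ((fderiv ℝ G z).hasFDerivAt.comp z
      ((hasFDerivAt_id z).sub_const z))).smul_const e)
    refine h2.congr_fderiv ?_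
    ext v
    simp
  have hΦd' : HasStrictFDerivAt Φ ((ContinuousLinearEquiv.refl ℝ E : E ≃L[ℝ] E) : E →L[ℝ] E) z :=
    hΦs.hasStrictFDerivAt' hΦd (by simp)
  have hinv := hΦs.to_localInverse hΦd (by simp)
  set ψ := hΦs.localInverse hΦd (by simp) with hψ
  have hψz : ψ z = z := by
    have := hΦs.localInverse_apply_image hΦd (by simp)
    rwa [hΦz] at this
  have hr : ∀ᶠ y in 𝓝 z, Φ (ψ y) = y := by
    have := hΦd'.eventually_right_inverse
    rwa [hΦz] at this
  have hψd : HasFDerivAt ψ ((ContinuousLinearEquiv.refl ℝ E).symm : E →L[ℝ] E) z := by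
    have := hΦd'.to_localInverse.hasFDerivAt
    rwa [hΦz] at this
  rw [hΦz] at hinv
  have hline : HasDerivAt (fun t : ℝ => z + t • u) u 0 := by
    simpa using ((hasDerivAt_id (0 : ℝ)).smul_const u).const_add z
  have h0 : z + (0 : ℝ) • u = z := by simp
  refine ⟨fun t => ψ (z + t • u), ?_, by simp [hψz], ?_, ?_⟩
  · refine ContDiffAt.comp (g := ψ) 0 ?_
      (contDiffAt_const.add (contDiffAt_id.smul contDiffAt_const))
    simpa using hinv
  · have := HasFDerivAt.comp_hasDerivAt_of_eq (0 : ℝ) hψd hline h0.symm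
    exact this
  · have ht : Tendsto (fun t : ℝ => z + t • u) (𝓝 0) (𝓝 z) := by
      have := hline.continuousAt.tendsto
      rwa [h0] at this
    filter_upwards [ht.eventually hr] with t ht
    have h1 := congrArg (fun y => fderiv ℝ G z (y - z)) ht
    simp only [hΦ, map_sub, map_add, map_smul, he, hu, smul_eq_mul, mul_one, mul_zero] at h1
    linear_combination h1

end Calculus

/-! ### Hypersurfaces and their invariant distributions in a chart -/

section Hypersurface

variable {E : Type*} [NormedAddCommGroup E] [NormedSpace ℝ E]
  {H : Type*} [TopologicalSpace H] (I : ModelWithCorners ℝ E H)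
  {M : Type*} [TopologicalSpace M] [ChartedSpace H M]

/-- `G` is an equation of `S` on the open subset `W` of the target of the preferred chart at `x`,
with surjective differential along `S`. -/
structure IsChartEquation {F : Type*} [NormedAddCommGroup F] [NormedSpace ℝ F] (S : Set M) (x : M)
    (W : Set E) (G : E → F) : Prop where
  isOpen : IsOpen W
  mem : extChartAt I x x ∈ W
  subset : W ⊆ (extChartAt I x).target
  contDiffOn : ContDiffOn ℝ ∞ G W
  mem_iff : ∀ z ∈ W, (extChartAt I x).symm z ∈ S ↔ G z = 0
  surjective : ∀ z ∈ W, G z = 0 → Function.Surjective (fderiv ℝ G z)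

variable {I} [IsManifold I ∞ M] [I.Boundaryless]

theorem IsEmbeddedSubmanifold.exists_chartEquation {S : Set M} {k : ℕ}
    (hS : IsEmbeddedSubmanifold I S k) {x : M} (hx : x ∈ S) :
    ∃ (W : Set E) (G : E → Fin k → ℝ), IsChartEquation I S x W G := by
  obtain ⟨U, hU, hxU, g, hg, hSU, hsurj⟩ := hS x hx
  set φ := extChartAt I x with hφ
  have hW : IsOpen (φ.target ∩ φ.symm ⁻¹' U) :=
    (continuousOn_extChartAt_symm x).isOpen_inter_preimage (isOpen_extChartAt_target x) hU
  refine ⟨φ.target ∩ φ.symm ⁻¹' U, g ∘ φ.symm, hW, ⟨mem_extChartAt_target x, ?_⟩,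
    inter_subset_left, ?_, ?_, ?_⟩
  · simpa [hφ] using hxU
  · intro z hz
    have h1 := (hg.contMDiffAt (hU.mem_nhds hz.2)).comp z (contMDiffAt_extChartAt_symm hz.1)
    exact h1.contDiffAt.contDiffWithinAt
  · intro z hz
    have : φ.symm z ∈ S ∩ U ↔ φ.symm z ∈ {y ∈ U | g y = 0} := by rw [hSU]
    rw [mem_inter_iff, mem_ofPred_eq, and_iff_left (mem_preimage.1 hz.2),
      and_iff_right (mem_preimage.1 hz.2)] at this
    exact this
  · intro z hz h0
    have hzS : φ.symm z ∈ S ∩ U := by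
      rw [hSU]
      exact ⟨hz.2, h0⟩
    have h1 := (hg.contMDiffAt (hU.mem_nhds hz.2)).mdifferentiableAt (by simp)
    have h2 := mfderiv_comp z h1
      ((contMDiffAt_extChartAt_symm hz.1).mdifferentiableAt (by simp))
    rw [mfderiv_eq_fderiv, mfderiv_extChartAt_symm] at h2
    intro r
    obtain ⟨w, hw⟩ := hsurj _ hzS r
    refine ⟨chartCotangent I x (φ.symm z) w, ?_⟩
    refine (DFunLike.congr_fun h2 _).trans ?_
    refine Eq.trans ?_ hw
    exact congrArg (mfderiv I 𝓘(ℝ, Fin k → ℝ) g (φ.symm z)) (chartTangent_chartCotangent hz.1 w)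

omit [I.Boundaryless] in
theorem isEmbeddedSubmanifold_of_chartEquation {S : Set M} {k : ℕ}
    (h : ∀ x ∈ S, ∃ (W : Set E) (G : E → Fin k → ℝ), IsChartEquation I S x W G) :
    IsEmbeddedSubmanifold I S k := by
  intro x hx
  obtain ⟨W, G, hG⟩ := h x hx
  set φ := extChartAt I x with hφ
  have hU : IsOpen (φ.source ∩ φ ⁻¹' W) :=
    (continuousOn_extChartAt x).isOpen_inter_preimage (isOpen_extChartAt_source x) hG.isOpen
  have hsm : ∀ y ∈ φ.source ∩ φ ⁻¹' W, ContMDiffAt I 𝓘(ℝ, E) ∞ φ y := fun y hy =>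
    contMDiffAt_extChartAt' (by rw [← extChartAt_source I]; exact hy.1)
  have hGs : ∀ y ∈ φ.source ∩ φ ⁻¹' W, ContDiffAt ℝ ∞ G (φ y) := fun y hy =>
    hG.contDiffOn.contDiffAt (hG.isOpen.mem_nhds hy.2)
  refine ⟨φ.source ∩ φ ⁻¹' W, hU, ⟨mem_extChartAt_source x, hG.mem⟩, G ∘ φ, ?_, ?_, ?_⟩
  · intro y hy
    exact ((hGs y hy).contMDiffAt.comp y (hsm y hy)).contMDiffWithinAt
  · ext y
    simp only [mem_inter_iff, mem_ofPred_eq, Function.comp]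
    rw [and_comm]
    refine and_congr_right fun hy => ?_
    rw [← hG.mem_iff _ hy.2, ← hφ, φ.left_inv hy.1]
  · rintro y ⟨hyS, hy⟩ r
    have h0 : G (φ y) = 0 := by
      rw [← hG.mem_iff _ hy.2, ← hφ, φ.left_inv hy.1]
      exact hyS
    obtain ⟨u, hu⟩ := hG.surjective _ hy.2 h0 r
    have h2 := mfderiv_comp y ((hGs y hy).contMDiffAt.mdifferentiableAt (by simp))
      ((hsm y hy).mdifferentiableAt (by simp))
    rw [mfderiv_eq_fderiv] at h2
    refine ⟨chartTangent I x (φ y) u, ?_⟩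
    refine (DFunLike.congr_fun h2 _).trans ?_
    refine Eq.trans ?_ hu
    have h3 := chartCotangent_chartTangent (I := I) (φ.map_source hy.1) u
    rw [φ.left_inv hy.1] at h3
    exact congrArg (fderiv ℝ G (φ y)) h3

/-- The tangent space of a submanifold as a set of vectors of the model space. -/
def tangentVectors (I : ModelWithCorners ℝ E H) (S : Set M) (y : M) : Set E := tangentSpaceOf I S y

/-- A hypersurface has a scalar chart equation at each of its points. -/
theorem IsEmbeddedSubmanifold.exists_scalar_chartEquation {S : Set M}
    (hS : IsEmbeddedSubmanifold I S 1) {x : M} (hx : x ∈ S) :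
    ∃ (W : Set E) (G : E → ℝ), IsChartEquation I S x W G := by
  obtain ⟨W, G, hG⟩ := hS.exists_chartEquation hx
  let L : (Fin 1 → ℝ) ≃L[ℝ] ℝ := ContinuousLinearEquiv.funUnique (Fin 1) ℝ ℝ
  refine ⟨W, fun z => L (G z), hG.isOpen, hG.mem, hG.subset,
    L.contDiff.comp_contDiffOn hG.contDiffOn, fun z hz => ?_, fun z hz h0 => ?_⟩
  · rw [hG.mem_iff z hz, L.map_eq_zero_iff]
  · rw [L.map_eq_zero_iff] at h0
    have hd := ((hG.contDiffOn.contDiffAt (hG.isOpen.mem_nhds hz)).differentiableAt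
      (by simp)).hasFDerivAt
    have h1 : HasFDerivAt (fun z => L (G z)) ((L : (Fin 1 → ℝ) →L[ℝ] ℝ).comp (fderiv ℝ G z)) z :=
      (L : (Fin 1 → ℝ) →L[ℝ] ℝ).hasFDerivAt.comp z hd
    rw [h1.fderiv]
    exact L.surjective.comp (hG.surjective z hz h0)

namespace IsChartEquation

variable {Γ : Set M} {x : M} {W : Set E} {G : E → ℝ}

omit [IsManifold I ∞ M] [I.Boundaryless] in
theorem contDiffAt (hG : IsChartEquation I Γ x W G) {z : E} (hz : z ∈ W) : ContDiffAt ℝ ∞ G z :=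
  hG.contDiffOn.contDiffAt (hG.isOpen.mem_nhds hz)

omit [IsManifold I ∞ M] [I.Boundaryless] in
theorem fderiv_ne_zero (hG : IsChartEquation I Γ x W G) {z : E} (hz : z ∈ W) (h0 : G z = 0) :
    fderiv ℝ G z ≠ 0 := by
  intro h
  obtain ⟨u, hu⟩ := hG.surjective z hz h0 1
  simp [h] at hu

/-- Differentiating G ∘ c = 0 gives one direction; `exists_curve_in_zero_set` supplies the curve for
the other. -/
theorem mem_tangentVectors [CompleteSpace E] (hG : IsChartEquation I Γ x W G) {z : E} (hz : z ∈ W)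
    (h0 : G z = 0) (u : E) :
    chartTangent I x z u ∈ tangentVectors I Γ ((extChartAt I x).symm z) ↔ fderiv ℝ G z u = 0 := by
  refine (chartTangent_mem_tangentSpaceOf (hG.subset hz) u).trans ?_
  constructor
  · rintro ⟨c, hc, hc0, hd, hS⟩
    subst hc0
    have h1 := ((hG.contDiffAt hz).differentiableAt (by simp)).hasFDerivAt.comp_hasDerivAt 0 hd
    have h2 : G ∘ c =ᶠ[𝓝 0] fun _ => 0 := by
      filter_upwards [hS, hc.continuousAt.preimage_mem_nhds (hG.isOpen.mem_nhds hz)] with t ht ht'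
      exact (hG.mem_iff _ ht').1 ht
    exact h1.unique ((hasDerivAt_const (0 : ℝ) (0 : ℝ)).congr_of_eventuallyEq h2)
  · intro hu
    obtain ⟨c, hc, hc0, hd, hS⟩ :=
      exists_curve_in_zero_set (hG.contDiffAt hz) h0 (hG.fderiv_ne_zero hz h0) hu
    refine ⟨c, hc, hc0, hd, ?_⟩
    subst hc0
    filter_upwards [hS, hc.continuousAt.preimage_mem_nhds (hG.isOpen.mem_nhds hz)] with t ht ht'
    exact (hG.mem_iff _ ht').2 ht

variable (J : AlmostComplexStructure I M)

omit [I.Boundaryless] in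
theorem _root_.AlmostComplex.mem_distribution_iff (y : M) (u : E) :
    (u : TangentSpace I y) ∈ J.distribution Γ y ↔
      u ∈ tangentVectors I Γ y ∧ J.endo y u ∈ tangentVectors I Γ y := Iff.rfl

theorem mem_distribution [CompleteSpace E] (hG : IsChartEquation I Γ x W G) {z : E} (hz : z ∈ W)
    (h0 : G z = 0) (u : E) :
    (chartTangent I x z u : TangentSpace I ((extChartAt I x).symm z)) ∈
      J.distribution Γ ((extChartAt I x).symm z) ↔
      fderiv ℝ G z u = 0 ∧ fderiv ℝ G z (J.inChart x z u) = 0 := by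
  rw [mem_distribution_iff, ← chartTangent_inChart J (hG.subset hz), hG.mem_tangentVectors hz h0,
    hG.mem_tangentVectors hz h0]

omit [IsManifold I ∞ M] [I.Boundaryless] in
theorem apply_self (hG : IsChartEquation I Γ x W G) (hx : x ∈ Γ) : G (extChartAt I x x) = 0 := by
  rw [← hG.mem_iff _ hG.mem, extChartAt_to_inv]
  exact hx

theorem mem_distribution_self [CompleteSpace E] (hG : IsChartEquation I Γ x W G) (hx : x ∈ Γ)
    (u : E) : (u : TangentSpace I x) ∈ J.distribution Γ x ↔
      fderiv ℝ G (extChartAt I x x) u = 0 ∧ fderiv ℝ G (extChartAt I x x) (J.endo x u) = 0 := by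
  have h1 := hG.mem_tangentVectors hG.mem (hG.apply_self hx) u
  have h2 := hG.mem_tangentVectors hG.mem (hG.apply_self hx) (J.endo x u)
  rw [chartTangent_self, extChartAt_to_inv] at h1 h2
  exact and_congr h1 h2

end IsChartEquation

end Hypersurface

/-! ### Comparison of defining forms; symmetry of the Levi form -/

section LocalForms

variable {E : Type*} [NormedAddCommGroup E] [NormedSpace ℝ E]

/-- The exterior derivative at `z` of the 1-form `dG ∘ j`, where `g = dG`, `g' = D²G` and `j' = Dj`
at `z`. -/
def dcomp (g : E →L[ℝ] ℝ) (g' : E →L[ℝ] E →L[ℝ] ℝ) (j : E →L[ℝ] E) (j' : E →L[ℝ] E →L[ℝ] E)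
    (v w : E) : ℝ :=
  g' v (j w) - g' w (j v) + g (j' v w - j' w v)

variable {G : E → ℝ} {j : E → E →L[ℝ] E} {z : E}

theorem fderiv_fderiv_comm (hG : ContDiffAt ℝ ∞ G z) (v w : E) :
    fderiv ℝ (fderiv ℝ G) z v w = fderiv ℝ (fderiv ℝ G) z w v := by
  have h2 : (2 : WithTop ℕ∞) ≤ ∞ := WithTop.coe_le_coe.2 (le_top : (2 : ℕ∞) ≤ ⊤)
  exact (hG.isSymmSndFDerivAt (by simpa using h2)) v w

/-- If `η` is a 1-form whose kernel on the level set `G = 0` is the `j`-invariant distribution, then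
`dη` is a nonzero multiple of `d (dG ∘ j)` on that distribution. -/
theorem exists_exteriorDeriv_eq [CompleteSpace E] {η : E → E →L[ℝ] ℝ} (hG : ContDiffAt ℝ ∞ G z)
    (hz : G z = 0) (hne : fderiv ℝ G z ≠ 0) (hj : DifferentiableAt ℝ j z)
    (hjj : ∀ u, j z (j z u) = -u) (hη : DifferentiableAt ℝ η z)
    (hker : ∀ᶠ y in 𝓝 z, G y = 0 → ∀ u, fderiv ℝ G y u = 0 →
      (η y u = 0 ↔ fderiv ℝ G y (j y u) = 0)) :
    ∃ a : ℝ, a ≠ 0 ∧ ∀ v w : E, fderiv ℝ G z v = 0 → fderiv ℝ G z (j z v) = 0 →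
      fderiv ℝ G z w = 0 → fderiv ℝ G z (j z w) = 0 →
      fderiv ℝ η z v w - fderiv ℝ η z w v =
        a * dcomp (fderiv ℝ G z) (fderiv ℝ (fderiv ℝ G) z) (j z) (fderiv ℝ j z) v w := by
  obtain ⟨e, he⟩ := DFunLike.ne_iff.1 hne
  replace he : fderiv ℝ G z e ≠ 0 := he
  have hG' : DifferentiableAt ℝ (fderiv ℝ G) z :=
    (hG.fderiv_right (m := ∞) (by simp)).differentiableAt (by simp)
  set g := fderiv ℝ G z with hg
  -- Since j² = -1, the determinant of dG and dG ∘ j on e and je is -(dG(e)² + dG(je)²), which is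
  -- nonzero.
  set f := j z e with hf
  have hgjf : g (j z f) = -g e := by rw [hf, hjj, map_neg]
  set Δ := g e * g (j z f) - g f * g (j z e) with hΔ
  have hΔ0 : Δ ≠ 0 := by
    have : Δ = -(g e ^ 2 + g f ^ 2) := by rw [hΔ, hgjf, hf]; ring
    rw [this]
    have := sq_nonneg (g f)
    have := pow_pos (abs_pos.2 he) 2
    rw [sq_abs] at this
    linarith
  have hker0 := hker.self_of_nhds hz
  -- The Cramer identity for `η` on the level set.
  have hcramer : ∀ w : E, ∀ᶠ y in 𝓝 z, G y = 0 →
      (fderiv ℝ G y e * fderiv ℝ G y (j y f) - fderiv ℝ G y f * fderiv ℝ G y (j y e)) * η y w -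
      (fderiv ℝ G y w * fderiv ℝ G y (j y f) - fderiv ℝ G y f * fderiv ℝ G y (j y w)) * η y e -
      (fderiv ℝ G y e * fderiv ℝ G y (j y w) - fderiv ℝ G y w * fderiv ℝ G y (j y e)) * η y f
        = 0 := by
    intro w
    filter_upwards [hker] with y hy h0
    -- By Cramer's rule this combination of w, e, f is killed by both dG and dG ∘ j, hence by η at
    -- points of the level set.
    have h1 := (hy h0
      ((fderiv ℝ G y e * fderiv ℝ G y (j y f) - fderiv ℝ G y f * fderiv ℝ G y (j y e)) • w -
      (fderiv ℝ G y w * fderiv ℝ G y (j y f) - fderiv ℝ G y f * fderiv ℝ G y (j y w)) • e -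
      (fderiv ℝ G y e * fderiv ℝ G y (j y w) - fderiv ℝ G y w * fderiv ℝ G y (j y e)) • f)
      (by simp only [map_sub, map_smul, smul_eq_mul]; ring)).2
      (by simp only [map_sub, map_smul, smul_eq_mul]; ring)
    simpa only [map_sub, map_smul, smul_eq_mul] using h1
  -- The Cramer identity is known only on the level set, so it is differentiated along a curve there
  -- with velocity v. As dG(w), dG(jw) and η(w) vanish at z, the derivatives of η(e), η(f) and of
  -- the determinant drop out.
  have hderiv : ∀ v w : E, g v = 0 → g w = 0 → g (j z w) = 0 →
      Δ * fderiv ℝ η z v w = (g e * η z f - g f * η z e) *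
        (fderiv ℝ (fderiv ℝ G) z v (j z w) + g (fderiv ℝ j z v w)) +
      (g (j z f) * η z e - g (j z e) * η z f) * fderiv ℝ (fderiv ℝ G) z v w := by
    intro v w hv hw hjw
    have hηw : η z w = 0 := (hker0 w hw).2 hjw
    obtain ⟨c, hc, hc0, hcd, hcS⟩ := exists_curve_in_zero_set hG hz hne hv
    subst hc0
    have dG : ∀ u : E, HasDerivAt (fun t => fderiv ℝ G (c t) u)
        (fderiv ℝ (fderiv ℝ G) (c 0) v u) 0 := fun u => by
      simpa using (hG'.hasFDerivAt.comp_hasDerivAt 0 hcd).clm_apply (hasDerivAt_const 0 u)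
    have dη : ∀ u : E, HasDerivAt (fun t => η (c t) u) (fderiv ℝ η (c 0) v u) 0 := fun u => by
      simpa using (hη.hasFDerivAt.comp_hasDerivAt 0 hcd).clm_apply (hasDerivAt_const 0 u)
    have dτ : ∀ u : E, HasDerivAt (fun t => fderiv ℝ G (c t) (j (c t) u))
        (fderiv ℝ (fderiv ℝ G) (c 0) v (j (c 0) u) + g (fderiv ℝ j (c 0) v u)) 0 := fun u => by
      have h1 := (hj.hasFDerivAt.comp_hasDerivAt 0 hcd).clm_apply (hasDerivAt_const 0 u)
      simpa using (hG'.hasFDerivAt.comp_hasDerivAt 0 hcd).clm_apply h1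
    have hall := ((((((dG e).mul (dτ f)).sub ((dG f).mul (dτ e))).mul (dη w)).sub
      ((((dG w).mul (dτ f)).sub ((dG f).mul (dτ w))).mul (dη e))).sub
      ((((dG e).mul (dτ w)).sub ((dG w).mul (dτ e))).mul (dη f)))
    have hzero := hall.unique ((hasDerivAt_const (0 : ℝ) (0 : ℝ)).congr_of_eventuallyEq (by
      filter_upwards [hcS, hc.continuousAt.eventually (hcramer w)] with t ht ht'
      exact ht' ht))
    simp only [Pi.mul_apply, Pi.sub_apply, ← hg, hw, hjw, hηw] at hzero
    linear_combination hzero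
  -- This is η on g(e)f - g(f)e, a vector of ker dG on which dG ∘ j equals Δ ≠ 0; the kernel
  -- hypothesis makes it nonzero.
  set A := g e * η z f - g f * η z e with hA
  have hA0 : A ≠ 0 := by
    intro h
    have h1 : η z (g e • f - g f • e) = 0 := by
      simpa only [map_sub, map_smul, smul_eq_mul] using h
    have h2 := (hker0 (g e • f - g f • e)
      (by simp only [map_sub, map_smul, smul_eq_mul, ← hg]; ring)).1 h1
    apply hΔ0
    simpa only [map_sub, map_smul, smul_eq_mul] using h2
  have hsymm : ∀ v w : E, fderiv ℝ (fderiv ℝ G) z v w = fderiv ℝ (fderiv ℝ G) z w v :=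
    fderiv_fderiv_comm hG
  refine ⟨A / Δ, div_ne_zero hA0 hΔ0, fun v w hv hjv hw hjw => ?_⟩
  have h1 := hderiv v w hv hw hjw
  have h2 := hderiv w v hw hv hjv
  -- Antisymmetrizing in v and w removes the remaining multiple of the Hessian D²G(v, w).
  rw [hsymm w v] at h2
  rw [dcomp, map_sub]
  field_simp
  linear_combination h1 - h2

/-- When the Nijenhuis tensor of `j` vanishes, `(v, w) ↦ d (dG ∘ j) (v, j w)` is symmetric. -/
theorem dcomp_symm {g : E →L[ℝ] ℝ} {g' : E →L[ℝ] E →L[ℝ] ℝ} {j : E →L[ℝ] E}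
    {j' : E →L[ℝ] E →L[ℝ] E} (hg' : ∀ v w, g' v w = g' w v) (hjj : ∀ u, j (j u) = -u)
    (hj' : ∀ v u, j' v (j u) = -j (j' v u))
    (hN : ∀ v w, j' (j v) w - j' (j w) v - j (j' v w - j' w v) = 0) (v w : E) :
    dcomp g g' j j' v (j w) = dcomp g g' j j' w (j v) := by
  -- Once the symmetric Hessian terms cancel, the two sides differ by exactly g of the Nijenhuis
  -- expression.
  have h1 := congrArg g (hN v w)
  simp only [map_sub, map_zero] at h1
  simp only [dcomp, hjj, hj', map_sub, map_neg, hg' (j w) (j v), hg' w v]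
  linear_combination h1

end LocalForms

/-! ### Contact, Levi non-degenerate and strongly pseudoconvex hypersurfaces -/

section Levi

variable {E : Type*} [NormedAddCommGroup E] [NormedSpace ℝ E]
  {H : Type*} [TopologicalSpace H] {I : ModelWithCorners ℝ E H}
  {M : Type*} [TopologicalSpace M] [ChartedSpace H M] [IsManifold I ∞ M] [I.Boundaryless]

theorem contDiffAt_oneForm_inChart {ϑ : OneForm I M} {U : Set M} {x : M} (hU : IsOpen U)
    (hx : x ∈ U) (hϑ : ContMDiffOn I (cotangentModel I) ∞
      (fun y => (TotalSpace.mk y (ϑ y) : CotangentBundle I M)) U) :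
    ContDiffAt ℝ ∞ (ϑ.inChart x) (extChartAt I x x) := by
  have h1 := (contMDiffAt_totalSpace.1 (hϑ.contMDiffAt (hU.mem_nhds hx))).2
  have h2 := h1.comp_of_eq (contMDiffAt_extChartAt_symm (mem_extChartAt_target (I := I) x))
    (extChartAt_to_inv x)
  refine ContMDiffAt.contDiffAt (h2.congr_of_eventuallyEq ?_)
  filter_upwards [extChartAt_target_mem_nhds (I := I) x] with z hz
  have hsrc := (extChartAt I x).map_target hz
  rw [extChartAt_source] at hsrc
  refine Eq.trans ?_
    (trivialization_cotangent x (cotangentPoint _ (ϑ.covector ((extChartAt I x).symm z))) hsrc).symm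
  rw [inChart_eq]
  refine congrArg (fun q => (ϑ.covector ((extChartAt I x).symm z)).comp (chartTangent I x q)) ?_
  exact ((extChartAt I x).right_inv hz).symm

variable (J : AlmostComplexStructure I M) {Γ : Set M} {x : M} {W : Set E} {G : E → ℝ}

/-- The exterior derivative at `x` of the 1-form `dG ∘ J`, in the preferred chart at `x`. -/
def AlmostComplexStructure.dLevi (G : E → ℝ) (x : M) (v w : E) : ℝ :=
  dcomp (fderiv ℝ G (extChartAt I x x)) (fderiv ℝ (fderiv ℝ G) (extChartAt I x x)) (J.endo x)
    (fderiv ℝ (J.inChart x) (extChartAt I x x)) v w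

/-- The kernel condition on ϑ along Γ, read in the chart, is the hypothesis of
`exists_exteriorDeriv_eq`. Every defining form can thus be compared with the single form dG ∘ J. -/
theorem IsChartEquation.exists_d_eq [CompleteSpace E] (hG : IsChartEquation I Γ x W G) (hx : x ∈ Γ)
    {U : Set M} {ϑ : OneForm I M} (hU : IsOpen U) (hxU : x ∈ U) (hϑ : J.IsDefiningOneForm Γ U ϑ) :
    ∃ a : ℝ, a ≠ 0 ∧ ∀ v w : E, (v : TangentSpace I x) ∈ J.distribution Γ x →
      (w : TangentSpace I x) ∈ J.distribution Γ x → ϑ.d x v w = a * J.dLevi G x v w := by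
  have hz := hG.apply_self hx
  have hker : ∀ᶠ y in 𝓝 (extChartAt I x x), G y = 0 → ∀ u, fderiv ℝ G y u = 0 →
      (ϑ.inChart x y u = 0 ↔ fderiv ℝ G y (J.inChart x y u) = 0) := by
    have hc := (continuousAt_extChartAt_symm (I := I) x).preimage_mem_nhds
      (hU.mem_nhds (by rwa [extChartAt_to_inv]))
    filter_upwards [hG.isOpen.mem_nhds hG.mem, hc] with y hy hyU h0 u hu
    have h1 := hϑ.2 ((extChartAt I x).symm y) ⟨(hG.mem_iff y hy).2 h0, hyU⟩
      (chartTangent I x y u) ((hG.mem_tangentVectors hy h0 u).2 hu)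
    have h2 := hG.mem_distribution J hy h0 u
    rw [and_iff_right hu] at h2
    exact h1.trans h2
  obtain ⟨a, ha, h⟩ := exists_exteriorDeriv_eq (hG.contDiffAt hG.mem) hz
    (hG.fderiv_ne_zero hG.mem hz) ((contDiffAt_inChart J x).differentiableAt (by simp))
    (inChart_inChart J (mem_extChartAt_target x))
    ((contDiffAt_oneForm_inChart hU hxU hϑ.1).differentiableAt (by simp)) hker
  refine ⟨a, ha, fun v w hv hw => ?_⟩
  rw [hG.mem_distribution_self J hx] at hv hw
  rw [inChart_self] at h
  rw [d_eq, h v w hv.1 hv.2 hw.1 hw.2]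
  rfl

/-- Differentiate j² = -1: the derivative of j anticommutes with j. -/
theorem fderiv_inChart_endo (x : M) (v u : E) :
    fderiv ℝ (J.inChart x) (extChartAt I x x) v (J.endo x u) =
      -J.endo x (fderiv ℝ (J.inChart x) (extChartAt I x x) v u) := by
  have hd := ((contDiffAt_inChart J x).differentiableAt (by simp)).hasFDerivAt
  have h1 := hd.clm_apply (hd.clm_apply (hasFDerivAt_const u (extChartAt I x x)))
  have h2 : (fun z => J.inChart x z (J.inChart x z u)) =ᶠ[𝓝 (extChartAt I x x)] fun _ => -u := by
    filter_upwards [extChartAt_target_mem_nhds (I := I) x] with z hz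
    exact inChart_inChart J hz u
  have h3 := DFunLike.congr_fun
    (h1.unique ((hasFDerivAt_const (-u) (extChartAt I x x)).congr_of_eventuallyEq h2)) v
  rw [eq_neg_iff_add_eq_zero, add_comm, ← inChart_self]
  simpa using h3

theorem dLevi_endo_symm (hJ : J.IsIntegrable) (hG : ContDiffAt ℝ ∞ G (extChartAt I x x))
    (v w : E) : J.dLevi G x v (J.endo x w) = J.dLevi G x w (J.endo x v) := by
  refine dcomp_symm (fderiv_fderiv_comm hG) (endo_endo J x) (fderiv_inChart_endo J x) ?_ v w
  intro v w
  rw [← nijenhuis_eq]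
  exact hJ x v w

theorem IsChartEquation.endo_mem_distribution [CompleteSpace E] (hG : IsChartEquation I Γ x W G)
    (hx : x ∈ Γ) {v : E} (hv : (v : TangentSpace I x) ∈ J.distribution Γ x) :
    (J.endo x v : TangentSpace I x) ∈ J.distribution Γ x := by
  rw [hG.mem_distribution_self J hx] at hv ⊢
  rw [endo_endo, map_neg, hv.1, neg_zero]
  exact ⟨hv.2, rfl⟩

theorem IsChartEquation.neg_mem_distribution [CompleteSpace E] (hG : IsChartEquation I Γ x W G)
    (hx : x ∈ Γ) {v : E} (hv : (v : TangentSpace I x) ∈ J.distribution Γ x) :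
    (-v : TangentSpace I x) ∈ J.distribution Γ x := by
  have := hG.endo_mem_distribution J hx (hG.endo_mem_distribution J hx hv)
  rw [endo_endo] at this
  exact this

/-- Integrability makes 𝕃 symmetric on 𝒟, so its symmetric part is -dϑ(v, Jw), and w ↦ Jw is a
bijection of 𝒟. The equivalence holds for each defining form separately. -/
theorem IsChartEquation.forall_leviSymm_iff [CompleteSpace E] (hG : IsChartEquation I Γ x W G)
    (hx : x ∈ Γ) (hJ : J.IsIntegrable) {U : Set M} {ϑ : OneForm I M} (hU : IsOpen U) (hxU : x ∈ U)
    (hϑ : J.IsDefiningOneForm Γ U ϑ) {v : TangentSpace I x} (hv : v ∈ J.distribution Γ x) :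
    (∀ w ∈ J.distribution Γ x, ϑ.d x v w = 0) ↔
      ∀ w ∈ J.distribution Γ x, J.leviSymm ϑ x v w = 0 := by
  obtain ⟨a, -, ha⟩ := hG.exists_d_eq J hx hU hxU hϑ
  have key : ∀ w ∈ J.distribution Γ x, J.leviSymm ϑ x v w = -ϑ.d x v (J x w) := by
    intro w hw
    have h1 : ϑ.d x v (J x w) = a * J.dLevi G x v (J.endo x w) :=
      ha v (J.endo x w) hv (hG.endo_mem_distribution J hx hw)
    have h2 : ϑ.d x w (J x v) = a * J.dLevi G x w (J.endo x v) :=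
      ha w (J.endo x v) hw (hG.endo_mem_distribution J hx hv)
    rw [dLevi_endo_symm J hJ (hG.contDiffAt hG.mem) v w, ← h2] at h1
    simp only [AlmostComplexStructure.leviSymm, AlmostComplexStructure.leviBilinear, h1]
    ring
  constructor
  · intro h w hw
    rw [key w hw, neg_eq_zero]
    exact h _ (hG.endo_mem_distribution J hx hw)
  · intro h w hw
    -- The test vector is J(-w), because J(J(-w)) = w.
    have hw' := hG.endo_mem_distribution J hx (hG.neg_mem_distribution J hx hw)
    have h1 := h _ hw'
    rw [key _ hw', neg_eq_zero] at h1
    have h2 : J x (J.endo x (-w)) = w := (J.sq_eq x (-w)).trans (neg_neg w)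
    exact (congrArg (ϑ.d x v) h2).symm.trans h1

theorem isContact_iff_isLeviNondegenerate [CompleteSpace E] (hJ : J.IsIntegrable)
    (hΓ : IsEmbeddedSubmanifold I Γ 1) : J.IsContact Γ ↔ J.IsLeviNondegenerate Γ := by
  refine forall₂_congr fun x hx => exists₂_congr fun U ϑ => ?_
  obtain ⟨W, G, hG⟩ := hΓ.exists_scalar_chartEquation hx
  refine and_congr_right fun hU => and_congr_right fun hxU => and_congr_right fun hϑ =>
    forall₂_congr fun v hv => ?_
  rw [hG.forall_leviSymm_iff J hx hJ hU hxU hϑ hv]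

/-- The non-degeneracy that makes the conormal bundle totally real, in the contact integrable
case. -/
theorem IsChartEquation.eq_zero_of_isContact [CompleteSpace E] (hG : IsChartEquation I Γ x W G)
    (hx : x ∈ Γ) (hJ : J.IsIntegrable) (hc : J.IsContact Γ) {v : E}
    (hv : (v : TangentSpace I x) ∈ J.distribution Γ x)
    (h : ∀ w : E, (w : TangentSpace I x) ∈ J.distribution Γ x → J.dLevi G x v w +
      (1 / 2) * fderiv ℝ G (extChartAt I x x) (J.nijenhuisBilin x v (J.endo x w)) = 0) :
    v = 0 := by
  obtain ⟨U, ϑ, hU, hxU, hϑ, hnd⟩ := hc x hx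
  obtain ⟨a, -, ha⟩ := hG.exists_d_eq J hx hU hxU hϑ
  refine hnd v hv fun w hw => ?_
  have h1 := h w hw
  have h2 : J.nijenhuisBilin x v (J.endo x w) = 0 := by
    rw [← nijenhuis_eq_bilin]
    exact hJ x v _
  rw [h2, map_zero, mul_zero, add_zero] at h1
  rw [ha v w hv hw, h1, mul_zero]

/-- The non-degeneracy that makes the conormal bundle totally real, in the strongly pseudoconvex
case. -/
theorem IsChartEquation.eq_zero_of_isStronglyPseudoconvex [CompleteSpace E]
    (hG : IsChartEquation I Γ x W G) (hx : x ∈ Γ) (hc : J.IsStronglyPseudoconvex Γ) {v : E}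
    (hv : (v : TangentSpace I x) ∈ J.distribution Γ x)
    (h : ∀ w : E, (w : TangentSpace I x) ∈ J.distribution Γ x → J.dLevi G x v w +
      (1 / 2) * fderiv ℝ G (extChartAt I x x) (J.nijenhuisBilin x v (J.endo x w)) = 0) :
    v = 0 := by
  obtain ⟨U, ϑ, hU, hxU, hϑ, hpos⟩ := hc x hx
  obtain ⟨a, -, ha⟩ := hG.exists_d_eq J hx hU hxU hϑ
  by_contra hne
  have hJv := hG.endo_mem_distribution J hx hv
  -- Testing on w = Jv turns the Nijenhuis term into N(v, -v) = 0, so integrability is not needed.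
  have h1 := h _ hJv
  rw [endo_endo, map_neg, nijenhuisBilin_self, neg_zero, map_zero, mul_zero, add_zero] at h1
  have h2 := hpos v hv hne
  have h3 : J.leviForm ϑ x v = -(a * J.dLevi G x v (J.endo x v)) := congrArg Neg.neg (ha _ _ hv hJv)
  rw [h3, h1] at h2
  simp at h2

end Levi

/-! ### A submersion whose zeros are the conormal covectors -/

section ConormalEquation

variable {E : Type*} [NormedAddCommGroup E] [NormedSpace ℝ E]

/-- An equation of the conormal bundle of `G = 0` where `dG e ≠ 0`, for `ℓ e = 1`. -/
def conormalEquation (G : E → ℝ) (e : E) (ℓ : E →L[ℝ] ℝ) (q : E × (E →L[ℝ] ℝ)) : E →L[ℝ] ℝ :=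
  fderiv ℝ G q.1 e • q.2 - q.2 e • fderiv ℝ G q.1 + G q.1 • ℓ

variable {G : E → ℝ} {e : E} {ℓ : E →L[ℝ] ℝ}

/-- The first two terms express that p is parallel to dG and always cancel at e. The free direction
of the dual is used by G • ℓ to encode G = 0. -/
theorem conormalEquation_apply_self (hℓ : ℓ e = 1) (q : E × (E →L[ℝ] ℝ)) :
    conormalEquation G e ℓ q e = G q.1 := by
  simp only [conormalEquation, add_apply, sub_apply, smul_apply, smul_eq_mul, hℓ]
  ring

theorem conormalEquation_eq_zero_iff (hℓ : ℓ e = 1) {q : E × (E →L[ℝ] ℝ)}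
    (hq : fderiv ℝ G q.1 e ≠ 0) :
    conormalEquation G e ℓ q = 0 ↔ G q.1 = 0 ∧ ∀ u, fderiv ℝ G q.1 u = 0 → q.2 u = 0 := by
  constructor
  · intro h
    have h0 : G q.1 = 0 := by rw [← conormalEquation_apply_self (G := G) hℓ q, h, zero_apply]
    refine ⟨h0, fun u hu => ?_⟩
    have h1 := DFunLike.congr_fun h u
    simp only [conormalEquation, add_apply, sub_apply, smul_apply, smul_eq_mul, hu, h0, mul_zero,
      zero_mul, sub_zero, add_zero, zero_apply] at h1
    exact (mul_eq_zero.1 h1).resolve_left hq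
  · rintro ⟨h0, h⟩
    ext u
    have h1 := h (fderiv ℝ G q.1 e • u - fderiv ℝ G q.1 u • e)
      (by simp only [map_sub, map_smul, smul_eq_mul]; ring)
    simp only [map_sub, map_smul, smul_eq_mul] at h1
    simp only [conormalEquation, add_apply, sub_apply, smul_apply, smul_eq_mul, h0, zero_mul,
      add_zero, zero_apply]
    linear_combination h1

theorem contDiffAt_conormalEquation {q : E × (E →L[ℝ] ℝ)} (hG : ContDiffAt ℝ ∞ G q.1) :
    ContDiffAt ℝ ∞ (conormalEquation G e ℓ) q := by
  have h1 : ContDiffAt ℝ ∞ (fun q : E × (E →L[ℝ] ℝ) => G q.1) q := hG.comp q contDiffAt_fst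
  have h2 : ContDiffAt ℝ ∞ (fun q : E × (E →L[ℝ] ℝ) => fderiv ℝ G q.1) q :=
    (hG.fderiv_right (m := ∞) (by simp)).comp q contDiffAt_fst
  exact (((h2.clm_apply contDiffAt_const).smul contDiffAt_snd).sub
    ((contDiffAt_snd.clm_apply contDiffAt_const).smul h2)).add (h1.smul contDiffAt_const)

/-- Vertical directions reach every covector vanishing at e, because the map is affine in p; the
direction (e, 0) has value dG(e) ≠ 0 at e and supplies the rest. -/
theorem surjective_fderiv_conormalEquation (hℓ : ℓ e = 1) {q : E × (E →L[ℝ] ℝ)}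
    (hG : ContDiffAt ℝ ∞ G q.1) (hq : fderiv ℝ G q.1 e ≠ 0) :
    Function.Surjective (fderiv ℝ (conormalEquation G e ℓ) q) := by
  have hd := ((contDiffAt_conormalEquation (e := e) (ℓ := ℓ) hG).differentiableAt
    (by simp)).hasFDerivAt
  set g := fderiv ℝ G q.1 with hg
  set F := fderiv ℝ (conormalEquation G e ℓ) q with hF
  have hvert : ∀ p : E →L[ℝ] ℝ, F (0, p) = g e • p - p e • g := by
    intro p
    have hline : HasDerivAt (fun t : ℝ => (q.1, q.2 + t • p)) ((0 : E), p) 0 :=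
      (hasDerivAt_const (0 : ℝ) q.1).prodMk
        (by simpa using ((hasDerivAt_id (0 : ℝ)).smul_const p).const_add q.2)
    have h1 := hd.comp_hasDerivAt_of_eq (0 : ℝ) hline (by simp)
    have h2 : conormalEquation G e ℓ ∘ (fun t : ℝ => (q.1, q.2 + t • p)) =
        fun t => conormalEquation G e ℓ q + t • (g e • p - p e • g) := by
      funext t
      ext u
      simp only [Function.comp, conormalEquation, add_apply, sub_apply, smul_apply, smul_eq_mul,
        ← hg]
      ring
    rw [h2] at h1
    refine h1.unique ?_
    simpa using ((hasDerivAt_id (0 : ℝ)).smul_const (g e • p - p e • g)).const_add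
      (conormalEquation G e ℓ q)
  have hhor : F (e, 0) e = g e := by
    have h1 := hd.clm_apply (hasFDerivAt_const e q)
    have h2 : (fun y => conormalEquation G e ℓ y e) = fun y => G y.1 :=
      funext fun y => conormalEquation_apply_self hℓ y
    rw [h2] at h1
    have h3 := h1.unique ((hG.differentiableAt (by simp)).hasFDerivAt.comp q hasFDerivAt_fst)
    simpa using DFunLike.congr_fun h3 (e, 0)
  intro r
  set s := r e / g e with hs
  set r' := r - s • F (e, 0) with hr'
  have hr'e : r' e = 0 := by
    simp only [hr', sub_apply, smul_apply, smul_eq_mul, hhor, hs]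
    field_simp
    ring
  refine ⟨s • (e, 0) + (0, (g e)⁻¹ • r'), ?_⟩
  rw [map_add, map_smul, hvert, smul_apply, hr'e, smul_zero, zero_smul, sub_zero, smul_smul,
    mul_inv_cancel₀ hq, one_smul, hr']
  abel

end ConormalEquation

/-! ### The conormal bundle is a totally real submanifold -/

section Conormal

variable {E : Type*} [NormedAddCommGroup E] [NormedSpace ℝ E]
  {H : Type*} [TopologicalSpace H] {I : ModelWithCorners ℝ E H}
  {M : Type*} [TopologicalSpace M] [ChartedSpace H M] [IsManifold I ∞ M] [I.Boundaryless]
  {Γ : Set M} {W : Set E} {G : E → ℝ}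

/-- The conormal bundle without the zero section, in the coordinates of a preferred chart. -/
theorem IsChartEquation.mem_conormalBundle [CompleteSpace E] {α : CotangentBundle I M}
    (hG : IsChartEquation I Γ α.proj W G) {z : E} (hz : z ∈ W) (p : E →L[ℝ] ℝ) :
    (extChartAt (cotangentModel I) α).symm (z, p) ∈ conormalBundle I Γ \ zeroSection I M ↔
      (G z = 0 ∧ ∀ u, fderiv ℝ G z u = 0 → p u = 0) ∧ p ≠ 0 := by
  have hzt := hG.subset hz
  rw [extChartAt_cotangent_symm α p hzt]
  set y := (extChartAt I α.proj).symm z with hy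
  set B := chartCotangent I α.proj y with hB
  have h1 : (cotangentPoint y (p.comp B) : CotangentBundle I M) ∈ conormalBundle I Γ ↔
      y ∈ Γ ∧ ∀ v ∈ tangentVectors I Γ y, p (B v) = 0 := Iff.rfl
  have h2 : (cotangentPoint y (p.comp B) : CotangentBundle I M) ∈ zeroSection I M ↔
      p.comp B = 0 := Iff.rfl
  rw [Set.mem_sdiff, h1, h2, hG.mem_iff z hz]
  refine and_congr (and_congr_right fun h0 => ?_) (not_congr ?_)
  · constructor
    · intro h u hu
      have h3 := h _ ((hG.mem_tangentVectors hz h0 u).2 hu)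
      rwa [hB, hy, chartCotangent_chartTangent hzt] at h3
    · intro h v hv
      refine h _ ((hG.mem_tangentVectors hz h0 (B v)).1 ?_)
      rwa [hB, hy, chartTangent_chartCotangent hzt]
  · constructor
    · intro h
      ext u
      have h3 := DFunLike.congr_fun h (chartTangent I α.proj z u)
      rwa [ContinuousLinearMap.comp_apply, hB, hy, chartCotangent_chartTangent hzt] at h3
    · rintro rfl
      exact ContinuousLinearMap.zero_comp _

theorem isEmbeddedSubmanifold_conormalBundle [FiniteDimensional ℝ E]
    (hΓ : IsEmbeddedSubmanifold I Γ 1) :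
    IsEmbeddedSubmanifold (cotangentModel I) (conormalBundle I Γ \ zeroSection I M)
      (finrank ℝ E) := by
  have : CompleteSpace E := FiniteDimensional.complete ℝ E
  refine isEmbeddedSubmanifold_of_chartEquation fun α hα => ?_
  obtain ⟨W, G, hG⟩ := hΓ.exists_scalar_chartEquation hα.1.1
  set z₀ := extChartAt I α.proj α.proj with hz₀
  have hG0 : G z₀ = 0 := hG.apply_self hα.1.1
  obtain ⟨e, he⟩ := DFunLike.ne_iff.1 (hG.fderiv_ne_zero hG.mem hG0)
  replace he : fderiv ℝ G z₀ e ≠ 0 := he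
  set ℓ := (fderiv ℝ G z₀ e)⁻¹ • fderiv ℝ G z₀ with hℓ'
  have hℓ : ℓ e = 1 := by rw [hℓ', smul_apply, smul_eq_mul, inv_mul_cancel₀ he]
  have hdim : finrank ℝ (E →L[ℝ] ℝ) = finrank ℝ (Fin (finrank ℝ E) → ℝ) := by
    rw [Module.finrank_fin_fun, ← (LinearMap.toContinuousLinearMap (𝕜 := ℝ) (E := E)
      (F' := ℝ)).finrank_eq]
    exact Subspace.dual_finrank_eq
  let L : (E →L[ℝ] ℝ) ≃L[ℝ] (Fin (finrank ℝ E) → ℝ) := ContinuousLinearEquiv.ofFinrankEq hdim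
  have hW' : IsOpen (W ∩ (fun z => fderiv ℝ G z e) ⁻¹' {0}ᶜ) := by
    refine ContinuousOn.isOpen_inter_preimage (fun z hz => ?_) hG.isOpen isOpen_compl_singleton
    exact (((hG.contDiffAt hz).fderiv_right (m := ∞) (by simp)).clm_apply
      contDiffAt_const).continuousAt.continuousWithinAt
  -- The factor {0}ᶜ removes the zero section, and the condition dG(e) ≠ 0 keeps the equation a
  -- submersion.
  refine ⟨(W ∩ (fun z => fderiv ℝ G z e) ⁻¹' {0}ᶜ) ×ˢ {0}ᶜ,
    fun q => L (conormalEquation G e ℓ q), hW'.prod isOpen_compl_singleton, ?_, ?_, ?_, ?_, ?_⟩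
  · rw [extChartAt_cotangent_self]
    exact ⟨⟨hG.mem, he⟩, hα.2⟩
  · intro q hq
    exact (mem_extChartAt_cotangent_target α q).2 (hG.subset hq.1.1)
  · intro q hq
    exact (L.contDiff.contDiffAt.comp q
      (contDiffAt_conormalEquation (hG.contDiffAt hq.1.1))).contDiffWithinAt
  · intro q hq
    rw [L.map_eq_zero_iff, conormalEquation_eq_zero_iff hℓ hq.1.2]
    exact (hG.mem_conormalBundle hq.1.1 q.2).trans (and_iff_left hq.2)
  · intro q hq _
    have hd := ((contDiffAt_conormalEquation (e := e) (ℓ := ℓ)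
      (hG.contDiffAt hq.1.1)).differentiableAt (by simp)).hasFDerivAt
    have h1 : HasFDerivAt (fun q => L (conormalEquation G e ℓ q))
        ((L : (E →L[ℝ] ℝ) →L[ℝ] (Fin (finrank ℝ E) → ℝ)).comp _) q :=
      (L : (E →L[ℝ] ℝ) →L[ℝ] (Fin (finrank ℝ E) → ℝ)).hasFDerivAt.comp q hd
    rw [h1.fderiv]
    exact L.surjective.comp
      (surjective_fderiv_conormalEquation hℓ (hG.contDiffAt hq.1.1) hq.1.2)

/-- The equations of the tangent space of the conormal bundle without the zero section. -/
theorem IsChartEquation.tangent_conormalBundle [CompleteSpace E] {α : CotangentBundle I M}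
    (hG : IsChartEquation I Γ α.proj W G)
    {V : E × (E →L[ℝ] ℝ)}
    (hV : V ∈ tangentVectors (cotangentModel I) (conormalBundle I Γ \ zeroSection I M) α)
    (u e : E) :
    fderiv ℝ G (extChartAt I α.proj α.proj) V.1 = 0 ∧
      V.2 u * fderiv ℝ G (extChartAt I α.proj α.proj) e +
        covector α u * fderiv ℝ (fderiv ℝ G) (extChartAt I α.proj α.proj) V.1 e =
      V.2 e * fderiv ℝ G (extChartAt I α.proj α.proj) u +
        covector α e * fderiv ℝ (fderiv ℝ G) (extChartAt I α.proj α.proj) V.1 u := by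
  have h := chartTangent_mem_tangentSpaceOf (I := cotangentModel I)
    (S := conormalBundle I Γ \ zeroSection I M) (mem_extChartAt_target (I := cotangentModel I) α) V
  have h0 : chartTangent (cotangentModel I) α (extChartAt (cotangentModel I) α α) V ∈
      tangentVectors (cotangentModel I) (conormalBundle I Γ \ zeroSection I M)
        ((extChartAt (cotangentModel I) α).symm (extChartAt (cotangentModel I) α α)) := by
    rwa [chartTangent_self, extChartAt_to_inv]
  obtain ⟨c, hc, hc0, hcd, hcS⟩ := h.1 h0
  rw [extChartAt_cotangent_self] at hc0
  set z₀ := extChartAt I α.proj α.proj with hz₀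
  have h1 : HasDerivAt (fun t => (c t).1) V.1 0 :=
    (ContinuousLinearMap.fst ℝ E (E →L[ℝ] ℝ)).hasFDerivAt.comp_hasDerivAt 0 hcd
  have h2 : HasDerivAt (fun t => (c t).2) V.2 0 :=
    (ContinuousLinearMap.snd ℝ E (E →L[ℝ] ℝ)).hasFDerivAt.comp_hasDerivAt 0 hcd
  have hc1 : (c 0).1 = z₀ := by rw [hc0]
  have hc2 : (c 0).2 = covector α := by rw [hc0]
  have hGd := hG.contDiffAt hG.mem
  have hcW : ∀ᶠ t in 𝓝 (0 : ℝ), (c t).1 ∈ W :=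
    h1.continuousAt.preimage_mem_nhds (hG.isOpen.mem_nhds (by rw [hc1]; exact hG.mem))
  -- Conormality is rewritten as p ∧ dG = 0 on the pair (u, e), an identity in t that can be
  -- differentiated.
  have hcS' : ∀ᶠ t in 𝓝 (0 : ℝ), G (c t).1 = 0 ∧
      (c t).2 u * fderiv ℝ G (c t).1 e - (c t).2 e * fderiv ℝ G (c t).1 u = 0 := by
    filter_upwards [hcS, hcW] with t ht htW
    have h3 := ((hG.mem_conormalBundle htW (c t).2).1 ht).1
    refine ⟨h3.1, ?_⟩
    have h4 := h3.2 (fderiv ℝ G (c t).1 e • u - fderiv ℝ G (c t).1 u • e)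
      (by simp only [map_sub, map_smul, smul_eq_mul]; ring)
    simp only [map_sub, map_smul, smul_eq_mul] at h4
    linear_combination h4
  constructor
  · have h3 := (hGd.differentiableAt (by simp)).hasFDerivAt.comp_hasDerivAt_of_eq 0 h1 hc1.symm
    exact h3.unique ((hasDerivAt_const (0 : ℝ) (0 : ℝ)).congr_of_eventuallyEq
      (hcS'.mono fun t ht => ht.1))
  · have hG' : HasFDerivAt (fderiv ℝ G) (fderiv ℝ (fderiv ℝ G) z₀) z₀ :=
      ((hGd.fderiv_right (m := ∞) (by simp)).differentiableAt (by simp)).hasFDerivAt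
    have dG : ∀ u : E, HasDerivAt (fun t => fderiv ℝ G (c t).1 u)
        (fderiv ℝ (fderiv ℝ G) z₀ V.1 u) 0 := fun u => by
      simpa using (hG'.comp_hasDerivAt_of_eq 0 h1 hc1.symm).clm_apply (hasDerivAt_const 0 u)
    have dp : ∀ u : E, HasDerivAt (fun t => (c t).2 u) (V.2 u) 0 := fun u => by
      simpa using h2.clm_apply (hasDerivAt_const 0 u)
    have hall := ((dp u).mul (dG e)).sub ((dp e).mul (dG u))
    have h3 := hall.unique ((hasDerivAt_const (0 : ℝ) (0 : ℝ)).congr_of_eventuallyEq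
      (hcS'.mono fun t ht => ht.2))
    rw [hc1, hc2] at h3
    linear_combination h3

variable (J : AlmostComplexStructure I M)

omit [IsManifold I ∞ M] [I.Boundaryless] in
theorem zero_mem_tangentVectors {S : Set M} {x : M} (hx : x ∈ S) :
    (0 : E) ∈ tangentVectors I S x := by
  refine ⟨fun _ => x, contMDiffAt_const, Eventually.of_forall fun _ => hx, ?_⟩
  refine congrArg (TotalSpace.mk x) ?_
  rw [mfderiv_const]
  rfl

theorem lift_zero (α : CotangentBundle I M) :
    (J.lift α (0 : E × (E →L[ℝ] ℝ)) : E × (E →L[ℝ] ℝ)) = 0 := by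
  refine (lift_apply J α 0).trans (Prod.ext (map_zero _) ?_)
  change J.liftCovector α 0 = 0
  simp [AlmostComplexStructure.liftCovector]

/-- The conormal bundle without the zero section is totally real if the distribution has the
non-degeneracy property `h`. -/
theorem isTotallyReal_conormalBundle [CompleteSpace E] (hΓ : IsEmbeddedSubmanifold I Γ 1)
    (h : ∀ x ∈ Γ, ∀ (W : Set E) (G : E → ℝ), IsChartEquation I Γ x W G → ∀ v : E,
      (v : TangentSpace I x) ∈ J.distribution Γ x →
      (∀ w : E, (w : TangentSpace I x) ∈ J.distribution Γ x → J.dLevi G x v w +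
        (1 / 2) * fderiv ℝ G (extChartAt I x x) (J.nijenhuisBilin x v (J.endo x w)) = 0) →
      v = 0) :
    IsTotallyReal (I := cotangentModel I) J.lift (conormalBundle I Γ \ zeroSection I M) := by
  intro α hα
  set S := conormalBundle I Γ \ zeroSection I M with hS
  have hx := hα.1.1
  refine Subset.antisymm ?_ ?_
  · rintro V ⟨hV, hV'⟩
    have key : ∀ V : E × (E →L[ℝ] ℝ), V ∈ tangentVectors (cotangentModel I) S α →
        ((J.endo α.proj V.1, J.liftCovector α V) : E × (E →L[ℝ] ℝ)) ∈
          tangentVectors (cotangentModel I) S α → V = 0 := by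
      intro V hV hV'
      obtain ⟨W, G, hG⟩ := hΓ.exists_scalar_chartEquation hx
      set z₀ := extChartAt I α.proj α.proj with hz₀
      have hne := hG.fderiv_ne_zero hG.mem (hG.apply_self hx)
      have hdist := fun u => hG.mem_distribution_self J hx u
      have hα' := (hG.mem_conormalBundle hG.mem (covector α)).1 (by
        rw [← extChartAt_cotangent_self, extChartAt_to_inv]
        exact hα)
      have hT := hG.tangent_conormalBundle hV
      have hT' := hG.tangent_conormalBundle hV'
      rw [← hz₀] at hne hdist hα' hT hT'
      obtain ⟨e, he⟩ := DFunLike.ne_iff.1 hne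
      replace he : fderiv ℝ G z₀ e ≠ 0 := he
      obtain ⟨lam, hlam⟩ : ∃ lam : ℝ, ∀ u, covector α u = lam * fderiv ℝ G z₀ u := by
        refine ⟨covector α e / fderiv ℝ G z₀ e, fun u => ?_⟩
        have h4 := hα'.1.2 (fderiv ℝ G z₀ e • u - fderiv ℝ G z₀ u • e)
          (by simp only [map_sub, map_smul, smul_eq_mul]; ring)
        simp only [map_sub, map_smul, smul_eq_mul] at h4
        field_simp
        linear_combination h4
      have hlam0 : lam ≠ 0 := by
        rintro rfl
        refine hα'.2 ?_
        ext u
        simp [hlam u]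
      -- The arguments `0 0` are dummies: the first equation of the tangent space does not involve u
      -- and e.
      have hVD : (V.1 : TangentSpace I α.proj) ∈ J.distribution Γ α.proj :=
        (hdist V.1).2 ⟨(hT 0 0).1, (hT' 0 0).1⟩
      have hD : ∀ w : E, fderiv ℝ G z₀ w = 0 → V.2 w =
          lam * fderiv ℝ (fderiv ℝ G) z₀ V.1 w := by
        intro w hw
        have h5 := (hT w e).2
        rw [hlam, hlam, hw] at h5
        apply mul_right_cancel₀ he
        linear_combination h5
      have hD' : ∀ w : E, fderiv ℝ G z₀ w = 0 → J.liftCovector α V w =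
          lam * fderiv ℝ (fderiv ℝ G) z₀ (J.endo α.proj V.1) w := by
        intro w hw
        have h5 := (hT' w e).2
        rw [hlam, hlam, hw] at h5
        apply mul_right_cancel₀ he
        linear_combination h5
      have hsymm := fderiv_fderiv_comm (hG.contDiffAt hG.mem)
      rw [← hz₀] at hsymm
      have hlift : ∀ w : E, J.liftCovector α V w = V.2 (J.endo α.proj w) +
          lam * fderiv ℝ G z₀ (fderiv ℝ (J.inChart α.proj) z₀ V.1 w -
            fderiv ℝ (J.inChart α.proj) z₀ w V.1) +
          (1 / 2) * (lam * fderiv ℝ G z₀ (J.nijenhuisBilin α.proj V.1 (J.endo α.proj w))) := by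
        intro w
        rw [← hlam, ← hlam]
        rfl
      -- On 𝒟 both w and Jw lie in ker dG, so `hD'` at w and `hD` at Jw turn the formula for the
      -- lift into λ times the equation in `h`.
      have hV1 : V.1 = 0 := by
        refine h α.proj hx W G hG V.1 hVD fun w hw => ?_
        rw [hdist] at hw
        have h6 := hlift w
        rw [hD' w hw.1, hD _ hw.2, hsymm] at h6
        simp only [AlmostComplexStructure.dLevi, dcomp, ← hz₀]
        apply mul_left_cancel₀ hlam0
        linear_combination -h6
      have hV2 : ∀ u, V.2 u * fderiv ℝ G z₀ e = V.2 e * fderiv ℝ G z₀ u := by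
        intro u
        have h5 := (hT u e).2
        simpa [hV1] using h5
      -- The vector dG(e)Je - dG(Je)e lies in ker dG, where the covector part of 𝕁V vanishes; for
      -- vertical V that part is V.2 ∘ J.
      have hV3 : V.2 (J.endo α.proj (fderiv ℝ G z₀ e • J.endo α.proj e -
          fderiv ℝ G z₀ (J.endo α.proj e) • e)) = 0 := by
        have h7 := hlift (fderiv ℝ G z₀ e • J.endo α.proj e -
          fderiv ℝ G z₀ (J.endo α.proj e) • e)
        rw [hD' _ (by simp only [map_sub, map_smul, smul_eq_mul]; ring)] at h7
        simpa [hV1] using h7.symm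
      have hV4 : V.2 e = 0 := by
        have h8 := hV2 (J.endo α.proj e)
        simp only [map_sub, map_smul, smul_eq_mul, endo_endo, map_neg] at hV3
        -- The sum of squares appears because J²e = -e; it is positive, so the multiple of dG that
        -- equals V.2 is zero.
        have h9 : V.2 e * (fderiv ℝ G z₀ e ^ 2 + fderiv ℝ G z₀ (J.endo α.proj e) ^ 2) = 0 := by
          linear_combination (-fderiv ℝ G z₀ e) * hV3 - fderiv ℝ G z₀ (J.endo α.proj e) * h8
        refine (mul_eq_zero.1 h9).resolve_right ?_
        have := pow_pos (abs_pos.2 he) 2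
        rw [sq_abs] at this
        have := sq_nonneg (fderiv ℝ G z₀ (J.endo α.proj e))
        linarith
      refine Prod.ext hV1 ?_
      ext u
      have h8 := hV2 u
      rw [hV4, zero_mul] at h8
      exact (mul_eq_zero.1 h8).resolve_right he
    exact key V hV (Eq.subst (motive := fun U : E × (E →L[ℝ] ℝ) =>
      U ∈ tangentVectors (cotangentModel I) S α) (lift_apply J α V) hV')
  · rintro _ rfl
    refine ⟨zero_mem_tangentVectors (I := cotangentModel I) hα, ?_⟩
    have h0 : (J.lift α (0 : E × (E →L[ℝ] ℝ)) : E × (E →L[ℝ] ℝ)) ∈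
        tangentVectors (cotangentModel I) S α := by
      rw [lift_zero]
      exact zero_mem_tangentVectors (I := cotangentModel I) hα
    exact h0

end Conormal

end AlmostComplex

end

theorem theorem3p3 {E : Type*} [NormedAddCommGroup E] [NormedSpace ℝ E] [FiniteDimensional ℝ E]
    (n : ℕ) (hE : Module.finrank ℝ E = 2 * n)
    {M : Type*} [TopologicalSpace M] [ChartedSpace E M] [IsManifold 𝓘(ℝ, E) ∞ M]
    (J : AlmostComplex.AlmostComplexStructure 𝓘(ℝ, E) M)
    (Γ : Set M) (hΓ : AlmostComplex.IsEmbeddedSubmanifold 𝓘(ℝ, E) Γ 1) :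
    (J.IsIntegrable → (J.IsContact Γ ↔ J.IsLeviNondegenerate Γ)) ∧
    ((J.IsIntegrable ∧ J.IsContact Γ) ∨ J.IsStronglyPseudoconvex Γ →
      AlmostComplex.IsEmbeddedSubmanifold (AlmostComplex.cotangentModel 𝓘(ℝ, E))
        (AlmostComplex.conormalBundle 𝓘(ℝ, E) Γ \ AlmostComplex.zeroSection 𝓘(ℝ, E) M) (2 * n) ∧
      AlmostComplex.IsTotallyReal J.lift
        (AlmostComplex.conormalBundle 𝓘(ℝ, E) Γ \ AlmostComplex.zeroSection 𝓘(ℝ, E) M)) := by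
  have : CompleteSpace E := FiniteDimensional.complete ℝ E
  refine ⟨fun hJ => AlmostComplex.isContact_iff_isLeviNondegenerate J hJ hΓ, fun h => ⟨?_, ?_⟩⟩
  · rw [← hE]
    exact AlmostComplex.isEmbeddedSubmanifold_conormalBundle hΓ
  · refine AlmostComplex.isTotallyReal_conormalBundle J hΓ fun x hx W G hG v hv hw => ?_
    rcases h with ⟨hJ, hc⟩ | hc
    · exact hG.eq_zero_of_isContact J hx hJ hc hv hw
    · exact hG.eq_zero_of_isStronglyPseudoconvex J hx hc hv hw
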